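/- Let $E$ be a countable set and let $R:E\times E\to\mathbb R$ satisfy $R(\eta,\xi)\ge 0$ for $\eta\ne\xi$, $R(\eta,\eta)<0$ and $\sum_{\xi\in E}R(\eta,\xi)=0$ for all $\eta\in E$. Put $\lambda(\eta)=-R(\eta,\eta)$, $p(\eta,\xi)=R(\eta,\xi)/\lambda(\eta)$ for $\xi\neq\eta$ and $p(\eta,\eta)=0$, and assume that the discrete-time Markov chain with transition probabilities $p$ is irreducible and recurrent. Under $\mathbf P_\eta$, let $Y=(Y_n)_{n\ge0}$ be this chain started from $\eta$, let $(e_n)_{n\ge 0}$ be i.i.d. mean-one exponential random variables independent of $Y$, and let $$T_n=\frac{e_n}{\lambda(Y_n)},\qquad \alpha(t)=\min\Big\{n\ge0:\sum_{i=0}^nT_i>t\Big\},\qquad \eta_t=Y_{\alpha(t)},\quad t\ge0,$$ so that $\{\eta_t:t\ge0\}$ is the continuous-time Markov chain with transition rates $R$. Let $h:E\to[0,\infty)$ with $F:=\{\eta\in E:h(\eta)>0\}\neq\varnothing$. The $h$-trace of $\{\eta_t\}$ is the $F$-valued process $$\eta^h_t=\eta_{\mathcal S^h_t},\qquad \mathcal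 S^h_t=\sup\{s\ge0:\mathcal T^h_s\le t\},\qquad \mathcal T^h_s=\int_0^s h(\eta_u)\,du .$$ For a process $X$ with state space $S$ (either $\eta_\cdot$ with $S=E$, or $\eta^h_\cdot$ with $S=F$), a nonzero function $\nu:S\to[0,\infty)$ is called an invariant measure if $\sum_{\eta\in S}\nu(\eta)\mathbf P_\eta[X_t=\xi]=\nu(\xi)$ for all $t\ge0$, $\xi\in S$, and a reversible measure if $\nu(\eta)\mathbf P_\eta[X_t=\xi]=\nu(\xi)\mathbf P_\xi[X_t=\eta]$ for all $t\ge0$, $\eta,\xi\in S$. The process $X$ is positive recurrent if every $\eta\in S$ is recurrent ($\{t\ge 0:X_t=\eta\}$ is unbounded $\mathbf P_\eta$-a.s.) and is either absorbing ($\mathbf P_\eta$-a.s. $X_t=\eta$ for all $t\ge 0$) or has finite mean return time, i.e. $\mathbf E_\eta[\tau^+_\eta]<\infty$ with $\tau^+_\eta=\inf\{t>0:X_t=\eta,\ X_s\ne X_0\text{ for some }0<s<t\}$. Let $\mu$ be an invariant measure for $\{\eta_t:t\ge0\}$ and let $\mu^h_o(\xi)=h(\xi)\mu(\xi)$ for $\xi\in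 F$. Then: 1. $\mu^h_o$ is an invariant measure for $\{\eta^h_t:t\ge0\}$. 2. If $h$ is $\mu$-integrable, i.e. $\sum_{\eta\in E}h(\eta)\mu(\eta)<\infty$, then $\{\eta^h_t:t\ge0\}$ is positive recurrent. 3. If $\mu$ is a reversible measure for $\{\eta_t:t\ge0\}$, then $\mu^h_o$ is a reversible measure for $\{\eta^h_t:t\ge0\}$. -/

import Mathlib

open MeasureTheory ProbabilityTheory Set Filter
open scoped NNReal ENNReal

noncomputable section

/-- Transition rates on `E`: nonnegative off-diagonal entries, strictly negative (finite) diagonal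
entries, rows summing to zero. -/
structure RateMatrix (E : Type*) where
  rate : E → E → ℝ
  rate_nonneg : ∀ η ξ, η ≠ ξ → 0 ≤ rate η ξ
  rate_diag_neg : ∀ η, rate η η < 0
  hasSum_rate : ∀ η, HasSum (rate η) 0

namespace RateMatrix

variable {E : Type*} (R : RateMatrix E)

/-- The holding rate `λ(η) = -R(η, η)`. -/
def holdingRate (η : E) : ℝ := -R.rate η η

lemma holdingRate_pos (η : E) : 0 < R.holdingRate η := by
  have := R.rate_diag_neg η
  unfold holdingRate
  linarith

open Classical in
/-- The jump probability `p(η, ξ)`: `R(η, ξ) / λ(η)` for `η ≠ ξ`, and `p(η, η) = 0`. -/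
def jumpProb (η ξ : E) : ℝ := if ξ = η then 0 else R.rate η ξ / R.holdingRate η

lemma jumpProb_nonneg (η ξ : E) : 0 ≤ R.jumpProb η ξ := by
  unfold jumpProb
  split_ifs with h
  · exact le_rfl
  · exact div_nonneg (R.rate_nonneg η ξ (Ne.symm h)) (R.holdingRate_pos η).le

lemma hasSum_jumpProb (η : E) : HasSum (R.jumpProb η) 1 := by
  classical
  have h1 := ((R.hasSum_rate η).update η 0).div_const (R.holdingRate η)
  have h2 : R.jumpProb η = fun ξ => Function.update (R.rate η) η 0 ξ / R.holdingRate η := by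
    funext ξ
    unfold jumpProb
    by_cases h : ξ = η
    · subst h; simp
    · simp [h]
  have h3 : (0 - R.rate η η + 0) / R.holdingRate η = 1 := by
    rw [zero_sub, add_zero]
    exact div_self (R.holdingRate_pos η).ne'
  rw [h2, ← h3]
  simpa using h1

/-- The law `p(η, ·)` of one step of the jump chain. -/
def jumpPMF (η : E) : PMF E :=
  ⟨fun ξ => ENNReal.ofReal (R.jumpProb η ξ), by
    have h := R.hasSum_jumpProb η
    rw [← ENNReal.ofReal_one, ← h.tsum_eq,
      ENNReal.ofReal_tsum_of_nonneg (R.jumpProb_nonneg η) h.summable]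
    exact ENNReal.summable.hasSum⟩

variable [Countable E] [MeasurableSpace E] [DiscreteMeasurableSpace E]

/-- The transition kernel of the jump chain. -/
def jumpKernel : Kernel E E := Kernel.ofFunOfCountable fun η => (R.jumpPMF η).toMeasure

instance : IsMarkovKernel R.jumpKernel :=
  ⟨fun η => by
    change IsProbabilityMeasure (R.jumpPMF η).toMeasure
    infer_instance⟩

/-- The same kernel, read as giving the law of the state at time `n + 1` from the states up to
time `n`; it looks at the state at time `n` only. -/
def stepKernel (n : ℕ) : Kernel ((i : Finset.Iic n) → (fun _ : ℕ => E) i) E :=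
  R.jumpKernel.comap (fun y => y ⟨n, Finset.mem_Iic.2 le_rfl⟩) (measurable_pi_apply _)

instance (n : ℕ) : IsMarkovKernel (R.stepKernel n) := by
  unfold stepKernel
  infer_instance

/-- The law on `ℕ → E` of the jump chain `Y` started from `η`: the Markov chain with transition
probabilities `p` (`fun _ => η` is its path up to time `0`). -/
def chainLaw (η : E) : Measure (ℕ → E) :=
  Kernel.traj (X := fun _ : ℕ => E) R.stepKernel 0 fun _ => η

/-- The jump chain is irreducible: from every state it reaches every state with positive
probability. -/
def ChainIrreducible : Prop :=
  ∀ η ξ : E, 0 < R.chainLaw η {y | ∃ n, y n = ξ}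

/-- The jump chain is recurrent: from every state it returns there infinitely often, almost
surely. -/
def ChainRecurrent : Prop :=
  ∀ η : E, ∀ᵐ y ∂(R.chainLaw η), ∃ᶠ n in atTop, y n = η

/-- `P_η`, the joint law of the jump chain `Y` started from `η` and of an independent sequence `e`
of i.i.d. mean-one exponential variables. -/
def law (η : E) : Measure ((ℕ → E) × (ℕ → ℝ)) :=
  (R.chainLaw η).prod (Measure.infinitePi fun _ : ℕ => expMeasure 1)

/-- The holding time `T_n = e_n / λ(Y_n)`. -/
def holdingTime (ω : (ℕ → E) × (ℕ → ℝ)) (n : ℕ) : ℝ := ω.2 n / R.holdingRate (ω.1 n)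

/-- `α(t) = min {n ≥ 0 : T_0 + ⋯ + T_n > t}`. -/
def jumpIndex (t : ℝ) (ω : (ℕ → E) × (ℕ → ℝ)) : ℕ :=
  sInf {n : ℕ | t < ∑ i ∈ Finset.range (n + 1), R.holdingTime ω i}

/-- The continuous-time Markov chain `η_t = Y_{α(t)}`, `t ≥ 0`. -/
def process (t : ℝ) (ω : (ℕ → E) × (ℕ → ℝ)) : E := ω.1 (R.jumpIndex t ω)

/-- The additive functional `∫_0^t h(η_s) ds`. -/
def additiveFunctional (h : E → ℝ≥0) (t : ℝ) (ω : (ℕ → E) × (ℕ → ℝ)) : ℝ≥0∞ :=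
  ∫⁻ s in Ioc 0 t, (h (R.process s ω) : ℝ≥0∞)

/-- The generalized inverse `sup {s ≥ 0 : ∫_0^s h(η_u) du ≤ t}` of the additive functional. -/
def inverseFunctional (h : E → ℝ≥0) (t : ℝ) (ω : (ℕ → E) × (ℕ → ℝ)) : ℝ :=
  sSup {s : ℝ | 0 ≤ s ∧ R.additiveFunctional h s ω ≤ ENNReal.ofReal t}

/-- The `h`-trace of the chain: the chain run along the generalized inverse. -/
def trace (h : E → ℝ≥0) (t : ℝ) (ω : (ℕ → E) × (ℕ → ℝ)) : E :=
  R.process (R.inverseFunctional h t ω) ω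

end RateMatrix

section Processes

variable {E Ω : Type*} [MeasurableSpace Ω]

/-! Below, `X t`, `t ≥ 0`, is a process whose law when started from `η ∈ S` is given by `P η`, and
`S` is its state space. A measure on `S` is given by its point masses, which are finite. -/

/-- `ν` is a (nonzero) invariant measure of the process:
`∑_η ν(η) P_η[X_t = ξ] = ν(ξ)` for all `t ≥ 0` and `ξ ∈ S`. -/
def IsInvariantMeasure (P : E → Measure Ω) (X : ℝ → Ω → E) (S : Set E) (ν : S → ℝ≥0) : Prop :=
  ν ≠ 0 ∧ ∀ t : ℝ, 0 ≤ t → ∀ ξ : S,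
    ∑' η : S, (ν η : ℝ≥0∞) * P η {ω | X t ω = ξ} = ν ξ

/-- `ν` is a (nonzero) reversible measure of the process:
`ν(η) P_η[X_t = ξ] = ν(ξ) P_ξ[X_t = η]` for all `t ≥ 0` and `η, ξ ∈ S`. -/
def IsReversibleMeasure (P : E → Measure Ω) (X : ℝ → Ω → E) (S : Set E) (ν : S → ℝ≥0) : Prop :=
  ν ≠ 0 ∧ ∀ t : ℝ, 0 ≤ t → ∀ η ξ : S,
    (ν η : ℝ≥0∞) * P η {ω | X t ω = ξ} = ν ξ * P ξ {ω | X t ω = η}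

/-- The first return time `inf {t > 0 : X_t = η, X_s ≠ X_0 for some 0 < s < t}` of the process to
`η`, which is infinite if there is no such `t`. -/
def returnTime (X : ℝ → Ω → E) (η : E) (ω : Ω) : ℝ≥0∞ :=
  ⨅ (t : ℝ) (_ : 0 < t ∧ X t ω = η ∧ ∃ s, 0 < s ∧ s < t ∧ X s ω ≠ X 0 ω), ENNReal.ofReal t

/-- The process is positive recurrent: every state is recurrent (the set of times spent there is
almost surely unbounded) and is either absorbing or has finite mean return time. -/
def IsPositiveRecurrent (P : E → Measure Ω) (X : ℝ → Ω → E) (S : Set E) : Prop :=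
  ∀ η ∈ S, (∀ᵐ ω ∂(P η), ¬ BddAbove {t : ℝ | 0 ≤ t ∧ X t ω = η}) ∧
    ((∀ᵐ ω ∂(P η), ∀ t : ℝ, 0 ≤ t → X t ω = η) ∨ ∫⁻ ω, returnTime X η ω ∂(P η) < ∞)

end Processes

end

/-! The jump chain together with its exponential clocks drives both processes: `η_t` holds state `ξ`
for `1 / λ(ξ)` times a mean-one exponential variable, and the `h`-trace for `h(ξ) / λ(ξ)` times the
same variable. For a process that holds state `ξ` for `w(ξ)` times an exponential variable, the
Laplace transform at `b` of `t ↦ P_η[X_t = ξ]` is `G(η, ξ) w(ξ)`, where `G` is the Green function of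
the jump chain killed with survival probabilities `1 / (1 + b w)`. As that chain is
recurrent, it follows that `σ w` is invariant or reversible for the process exactly when `σ` is so
for the jump chain, a condition in which `w` does not appear. For `σ = λ μ` this carries `μ` over
to `h μ`.

For positive recurrence, the expected trace time that a round trip `η → ξ → η` takes is the sum of
two taboo potentials of `h / λ`. They are finite because the Green function of the chain that is
stopped at its return to `b` satisfies `σ(b) G(b, ·) ≤ σ`, so that `σ(b)` times the potential at `b`
is at most `∑ h μ`. -/

noncomputable section

/-! ### Green functions, balance equations and taboo potentials -/

section Green

variable {E : Type*}

open Classical in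
/-- The `n`-step weights of the kernel `p` when every visited state `ξ`, including the initial and
the final one, contributes a factor `z ξ`. -/
def killedPower (p : E → E → ℝ≥0∞) (z : E → ℝ≥0∞) : ℕ → E → E → ℝ≥0∞
  | 0 => fun η ξ => if η = ξ then z ξ else 0
  | n + 1 => fun η ξ => (∑' ζ, killedPower p z n η ζ * p ζ ξ) * z ξ

/-- The Green function of the kernel `p` with the weights `z` of `killedPower`. -/
def green (p : E → E → ℝ≥0∞) (z : E → ℝ≥0∞) (η ξ : E) : ℝ≥0∞ := ∑' n, killedPower p z n η ξ

/-- The potential of the charge `c` with respect to `green p z`. -/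
def potential (p : E → E → ℝ≥0∞) (z c : E → ℝ≥0∞) (ξ : E) : ℝ≥0∞ := ∑' η, c η * green p z η ξ

/-- `σ` satisfies the global balance equations of the kernel `p`: it is an invariant measure of the
discrete-time chain. -/
def GlobalBalance (p : E → E → ℝ≥0∞) (σ : E → ℝ≥0∞) : Prop := ∀ ξ, ∑' ζ, σ ζ * p ζ ξ = σ ξ

/-- `σ` satisfies the detailed balance equations of the kernel `p`: it is a reversible measure of
the discrete-time chain. -/
def DetailedBalance (p : E → E → ℝ≥0∞) (σ : E → ℝ≥0∞) : Prop := ∀ η ξ, σ η * p η ξ = σ ξ * p ξ η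

/-- The Laplace transform at `1` of an exponential time of mean `W η`: the probability that such a
time ends before an independent exponential clock of rate one rings. -/
def discount (W : E → ℝ≥0) (η : E) : ℝ≥0∞ := (1 + (W η : ℝ≥0∞))⁻¹

variable (p : E → E → ℝ≥0∞) (z : E → ℝ≥0∞)

open Classical in
lemma killedPower_zero (η ξ : E) : killedPower p z 0 η ξ = if η = ξ then z ξ else 0 := rfl

lemma killedPower_succ (n : ℕ) (η ξ : E) :
    killedPower p z (n + 1) η ξ = (∑' ζ, killedPower p z n η ζ * p ζ ξ) * z ξ := rfl

lemma killedPower_succ' (n : ℕ) (η ξ : E) :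
    killedPower p z (n + 1) η ξ = z η * ∑' ζ, p η ζ * killedPower p z n ζ ξ := by
  induction n generalizing ξ with
  | zero =>
    simp only [killedPower_succ, killedPower_zero, ite_mul, mul_ite, zero_mul, mul_zero,
      tsum_ite_eq, tsum_ite_eq']
    ring
  | succ n ih =>
    rw [killedPower_succ]
    simp only [ih, killedPower_succ p z n, ← ENNReal.tsum_mul_left, ← ENNReal.tsum_mul_right]
    rw [ENNReal.tsum_comm]
    exact tsum_congr fun ζ => tsum_congr fun θ => by ring

lemma potential_eq_tsum (c : E → ℝ≥0∞) (ξ : E) :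
    potential p z c ξ = ∑' n, ∑' η, c η * killedPower p z n η ξ := by
  simp only [potential, green, ← ENNReal.tsum_mul_left]
  exact ENNReal.tsum_comm

lemma tsum_mul_killedPower_zero (c : E → ℝ≥0∞) (ξ : E) :
    ∑' η, c η * killedPower p z 0 η ξ = c ξ * z ξ := by
  simp only [killedPower_zero, mul_ite, mul_zero, tsum_ite_eq]

lemma tsum_mul_killedPower_succ (c : E → ℝ≥0∞) (n : ℕ) (ξ : E) :
    ∑' η, c η * killedPower p z (n + 1) η ξ
      = (∑' ζ, (∑' η, c η * killedPower p z n η ζ) * p ζ ξ) * z ξ := by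
  simp only [killedPower_succ, ← ENNReal.tsum_mul_left, ← ENNReal.tsum_mul_right]
  rw [ENNReal.tsum_comm]
  exact tsum_congr fun ζ => tsum_congr fun θ => by ring

lemma potential_eq (c : E → ℝ≥0∞) (ξ : E) :
    potential p z c ξ = (c ξ + ∑' ζ, potential p z c ζ * p ζ ξ) * z ξ := by
  have hcomm : ∑' n, ∑' ζ, (∑' η, c η * killedPower p z n η ζ) * p ζ ξ
      = ∑' ζ, potential p z c ζ * p ζ ξ := by
    rw [ENNReal.tsum_comm]
    simp only [potential_eq_tsum, ENNReal.tsum_mul_right]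
  rw [potential_eq_tsum, tsum_eq_zero_add' ENNReal.summable, tsum_mul_killedPower_zero, add_mul,
    ← hcomm, ← ENNReal.tsum_mul_right]
  simp only [tsum_mul_killedPower_succ]

/-- Together with `potential_eq`: the potential of a charge is the least supersolution of the
equation `f = (c + f p) z`. -/
lemma potential_le_of_supersolution {c f : E → ℝ≥0∞}
    (hf : ∀ ξ, (c ξ + ∑' ζ, f ζ * p ζ ξ) * z ξ ≤ f ξ) (ξ : E) : potential p z c ξ ≤ f ξ := by
  rw [potential_eq_tsum, ENNReal.tsum_eq_iSup_nat]
  refine iSup_le fun N => ?_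
  induction N generalizing ξ with
  | zero => simp
  | succ N ih =>
    calc ∑ n ∈ Finset.range (N + 1), ∑' η, c η * killedPower p z n η ξ
        = (c ξ + ∑' ζ, (∑ n ∈ Finset.range N, ∑' η, c η * killedPower p z n η ζ) * p ζ ξ)
            * z ξ := by
          simp only [Finset.sum_range_succ', tsum_mul_killedPower_succ, tsum_mul_killedPower_zero,
            Finset.sum_mul, add_mul, Summable.tsum_finsetSum fun _ _ => ENNReal.summable]
          rw [add_comm]
      _ ≤ (c ξ + ∑' ζ, f ζ * p ζ ξ) * z ξ := by gcongr with ζ; exact ih ζ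
      _ ≤ f ξ := hf ξ

open Classical in
lemma green_eq_right (η ξ : E) :
    green p z η ξ = ((if η = ξ then 1 else 0) + ∑' ζ, green p z η ζ * p ζ ξ) * z ξ := by
  simpa [potential, eq_comm] using potential_eq p z (fun ζ => if ζ = η then 1 else 0) ξ

open Classical in
lemma green_eq_left (η ξ : E) :
    green p z η ξ = z η * ((if η = ξ then 1 else 0) + ∑' ζ, p η ζ * green p z ζ ξ) := by
  have hcomm : ∑' n, ∑' ζ, p η ζ * killedPower p z n ζ ξ = ∑' ζ, p η ζ * green p z ζ ξ := by
    simp only [green, ← ENNReal.tsum_mul_left]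
    exact ENNReal.tsum_comm
  rw [green, tsum_eq_zero_add' ENNReal.summable, mul_add, ← hcomm, ← ENNReal.tsum_mul_left]
  simp only [killedPower_succ', killedPower_zero]
  split_ifs with h <;> simp [h]

lemma globalBalance_of_excessive {S : E → ℝ≥0∞} (hrec : ∀ x, green p 1 x x = ∞)
    (hfin : ∀ ξ, S ξ ≠ ∞) (hS : ∀ ξ, ∑' ζ, S ζ * p ζ ξ ≤ S ξ) : GlobalBalance p S := by
  intro ξ
  set defect : E → ℝ≥0∞ := fun ξ => S ξ - ∑' ζ, S ζ * p ζ ξ with hdefect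
  have hpot : potential p 1 defect ξ ≤ S ξ := potential_le_of_supersolution p 1
    (fun ξ => by simp [hdefect, tsub_add_cancel_of_le (hS ξ)]) ξ
  have hmul : defect ξ * ∞ ≤ S ξ := hrec ξ ▸ (ENNReal.le_tsum ξ).trans hpot
  have hzero : defect ξ = 0 := by
    by_contra h
    rw [ENNReal.mul_top h, top_le_iff] at hmul
    exact hfin ξ hmul
  exact (hS ξ).antisymm (tsub_eq_zero_iff_le.1 hzero)

section Discount

variable (W : E → ℝ≥0)

lemma discount_ne_zero (η : E) : discount W η ≠ 0 := by simp [discount]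

lemma discount_ne_top (η : E) : discount W η ≠ ∞ := by simp [discount]

lemma mul_one_add_mul_discount (η : E) (a : ℝ≥0∞) : a * (1 + W η) * discount W η = a := by
  rw [discount, mul_assoc, ENNReal.mul_inv_cancel (by simp) (by simp), mul_one]

lemma potential_discount_eq (c : E → ℝ≥0∞) (ξ : E) :
    potential p (discount W) c ξ * (1 + W ξ)
      = c ξ + ∑' ζ, potential p (discount W) c ζ * p ζ ξ := by
  conv_lhs => rw [potential_eq, mul_right_comm, mul_one_add_mul_discount]

lemma globalBalance_of_potential_discount {σ : E → ℝ≥0∞} (hσ : ∀ ξ, σ ξ ≠ ∞)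
    (h : ∀ ξ, potential p (discount W) (fun η => σ η * W η) ξ = σ ξ) : GlobalBalance p σ := by
  intro ξ
  have heq := potential_discount_eq p W (fun η => σ η * W η) ξ
  simp only [h, mul_add, mul_one] at heq
  rw [add_comm] at heq
  exact ((ENNReal.add_right_inj (ENNReal.mul_ne_top (hσ ξ) ENNReal.coe_ne_top)).1 heq).symm

lemma potential_discount_of_globalBalance {σ : E → ℝ≥0∞} (hrec : ∀ x, green p 1 x x = ∞)
    (hσ : ∀ ξ, σ ξ ≠ ∞) (h : GlobalBalance p σ) {ξ : E} (hξ : W ξ ≠ 0) :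
    potential p (discount W) (fun η => σ η * W η) ξ = σ ξ := by
  set S := potential p (discount W) fun η => σ η * W η
  have hle : ∀ ξ, S ξ ≤ σ ξ := potential_le_of_supersolution p _ fun ξ => by
    rw [h ξ, show σ ξ * W ξ + σ ξ = σ ξ * (1 + W ξ) by ring, mul_one_add_mul_discount]
  have hfin : ∀ ξ, S ξ ≠ ∞ := fun ξ => ne_top_of_le_ne_top (hσ ξ) (hle ξ)
  have heq : ∀ ξ, S ξ * W ξ + S ξ = σ ξ * W ξ + ∑' ζ, S ζ * p ζ ξ := fun ξ => by
    rw [add_comm, ← mul_one_add, potential_discount_eq]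
  have hexc : ∀ ξ, ∑' ζ, S ζ * p ζ ξ ≤ S ξ := fun ξ =>
    (ENNReal.add_le_add_iff_left (ENNReal.mul_ne_top (hfin ξ) ENNReal.coe_ne_top)).1
      ((add_le_add_left (mul_le_mul_left (hle ξ) _) _).trans (heq ξ).ge)
  have hmul := heq ξ
  rw [globalBalance_of_excessive p hrec hfin hexc ξ] at hmul
  exact (ENNReal.mul_left_inj (by exact_mod_cast hξ) ENNReal.coe_ne_top).1
    ((ENNReal.add_left_inj (hfin ξ)).1 hmul)

end Discount

section Symmetry

variable {p z} {σ : E → ℝ≥0∞}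

lemma detailedBalance_killedPower (h : DetailedBalance p σ) (n : ℕ) :
    DetailedBalance (killedPower p z n) σ := by
  induction n with
  | zero =>
    intro η ξ
    obtain rfl | hne := eq_or_ne η ξ
    · rfl
    · simp [killedPower_zero, hne, hne.symm]
  | succ n ih =>
    intro η ξ
    rw [killedPower_succ, killedPower_succ', ← mul_assoc, ← ENNReal.tsum_mul_left, mul_left_comm,
      ← ENNReal.tsum_mul_left, mul_comm]
    congr 1
    exact tsum_congr fun ζ => by rw [← mul_assoc, ih, mul_right_comm, h, mul_assoc]

lemma detailedBalance_green (h : DetailedBalance p σ) : DetailedBalance (green p z) σ :=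
  fun η ξ => by simp only [green, ← ENNReal.tsum_mul_left, detailedBalance_killedPower h _ η ξ]

lemma eq_of_potential_eq (hz : ∀ ξ, z ξ ≠ 0) (hz' : ∀ ξ, z ξ ≠ ∞) {a b : E → ℝ≥0∞}
    (hfin : ∀ ξ, potential p z a ξ ≠ ∞) (h : potential p z a = potential p z b) : a = b := by
  funext ξ
  have ha := potential_eq p z a ξ
  have hb := potential_eq p z b ξ
  rw [← h, ha, ENNReal.mul_left_inj (hz ξ) (hz' ξ)] at hb
  have hsum : ∑' ζ, potential p z a ζ * p ζ ξ ≠ ∞ := fun htop =>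
    hfin ξ (by rw [ha, htop, add_top, ENNReal.top_mul (hz ξ)])
  exact (ENNReal.add_left_inj hsum).1 hb

lemma potential_mul_eq_of_detailedBalance (hG : DetailedBalance (green p z) σ) (ξ θ : E) :
    potential p z (fun ζ => σ ζ * p ζ ξ) θ = σ θ * ∑' ζ, green p z θ ζ * p ζ ξ := by
  rw [potential, ← ENNReal.tsum_mul_left]
  exact tsum_congr fun ζ => by rw [mul_right_comm, hG, mul_assoc]

lemma potential_const_mul_eq (ξ θ : E) :
    potential p z (fun ζ => σ ξ * p ξ ζ) θ = σ ξ * ∑' ζ, p ξ ζ * green p z ζ θ := by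
  rw [potential, ← ENNReal.tsum_mul_left]
  exact tsum_congr fun ζ => mul_assoc _ _ _

lemma mul_tsum_green_mul_eq (hz : ∀ ξ, z ξ ≠ 0) (hz' : ∀ ξ, z ξ ≠ ∞) (hσ : ∀ ξ, σ ξ ≠ ∞)
    (hG : DetailedBalance (green p z) σ) (ξ θ : E) :
    σ θ * ∑' ζ, green p z θ ζ * p ζ ξ = σ ξ * ∑' ζ, p ξ ζ * green p z ζ θ := by
  classical
  have h := hG θ ξ
  rw [green_eq_right, green_eq_left, mul_comm (z ξ), ← mul_assoc, ← mul_assoc,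
    ENNReal.mul_left_inj (hz ξ) (hz' ξ), mul_add, mul_add] at h
  obtain rfl | hne := eq_or_ne θ ξ
  · simpa [ENNReal.add_right_inj (hσ θ)] using h
  · simpa [hne, hne.symm] using h

/-- Both sides of the detailed balance equations of `p`, as charges in the first variable, have the
same potential. -/
lemma detailedBalance_of_green (hz : ∀ ξ, z ξ ≠ 0) (hz' : ∀ ξ, z ξ ≠ ∞) (hσ : ∀ ξ, σ ξ ≠ ∞)
    (hfin : ∀ η ξ, green p z η ξ ≠ ∞) (hG : DetailedBalance (green p z) σ) :
    DetailedBalance p σ := by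
  intro η ξ
  have hsum (θ : E) : ∑' ζ, green p z θ ζ * p ζ ξ ≠ ∞ := fun htop => by
    classical
    exact hfin θ ξ (by rw [green_eq_right, htop, add_top, ENNReal.top_mul (hz ξ)])
  refine congrFun (eq_of_potential_eq (p := p) hz hz' (a := fun ζ => σ ζ * p ζ ξ)
    (b := fun ζ => σ ξ * p ξ ζ) (fun θ => ?_) (funext fun θ => ?_)) η
  · rw [potential_mul_eq_of_detailedBalance hG]
    exact ENNReal.mul_ne_top (hσ θ) (hsum θ)
  · rw [potential_mul_eq_of_detailedBalance hG, potential_const_mul_eq,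
      mul_tsum_green_mul_eq hz hz' hσ hG]

end Symmetry

end Green

section Taboo

variable {E : Type*} (p : E → E → ℝ≥0∞)

open Classical in
/-- The kernel `p` with the entrances into `b` removed. -/
def tabooKernel (b η ξ : E) : ℝ≥0∞ := if ξ = b then 0 else p η ξ

/-- The expected `w`-weight collected by the chain before its first return to `b`. -/
def tabooPotential (w : E → ℝ≥0∞) (b η : E) : ℝ≥0∞ :=
  ∑' ξ, green (tabooKernel p b) 1 η ξ * w ξ

variable (w : E → ℝ≥0∞) (b : E)

lemma tabooPotential_eq (η : E) :
    tabooPotential p w b η = w η + ∑' ξ, tabooKernel p b η ξ * tabooPotential p w b ξ := by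
  classical
  have hcomm : ∑' ζ, (∑' ξ, tabooKernel p b η ξ * green (tabooKernel p b) 1 ξ ζ) * w ζ
      = ∑' ξ, tabooKernel p b η ξ * tabooPotential p w b ξ := by
    simp only [tabooPotential, ← ENNReal.tsum_mul_left, ← ENNReal.tsum_mul_right]
    rw [ENNReal.tsum_comm]
    simp only [mul_assoc]
  have hterm (ζ : E) : green (tabooKernel p b) 1 η ζ * w ζ = (if η = ζ then w ζ else 0)
      + (∑' ξ, tabooKernel p b η ξ * green (tabooKernel p b) 1 ξ ζ) * w ζ := by
    rw [green_eq_left, Pi.one_apply, one_mul, add_mul, ite_mul, one_mul, zero_mul]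
  rw [tabooPotential, tsum_congr hterm, ENNReal.tsum_add, tsum_ite_eq', hcomm]

lemma mul_green_tabooKernel_le {σ : E → ℝ≥0∞} (h : GlobalBalance p σ) (ξ : E) :
    σ b * green (tabooKernel p b) 1 b ξ ≤ σ ξ := by
  classical
  have hpot : potential (tabooKernel p b) 1 (fun η => if η = b then σ b else 0) ξ ≤ σ ξ :=
    potential_le_of_supersolution _ _ (fun ξ => by
      obtain rfl | hξ := eq_or_ne ξ b
      · simp [tabooKernel]
      · simp [tabooKernel, hξ, h ξ]) ξ
  simpa [potential] using hpot

lemma mul_tabooPotential_self_le {σ : E → ℝ≥0∞} (h : GlobalBalance p σ) :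
    σ b * tabooPotential p w b b ≤ ∑' ξ, σ ξ * w ξ := by
  rw [tabooPotential, ← ENNReal.tsum_mul_left]
  refine ENNReal.tsum_le_tsum fun ξ => ?_
  rw [← mul_assoc]
  gcongr
  exact mul_green_tabooKernel_le p b h ξ

variable {p w b}

lemma tabooPotential_ne_top_of_step {ζ η : E} (hζ : tabooPotential p w b ζ ≠ ∞) (hη : η ≠ b)
    (hp : p ζ η ≠ 0) : tabooPotential p w b η ≠ ∞ := by
  intro htop
  rw [tabooPotential_eq] at hζ
  refine hζ (top_le_iff.1 (le_trans ?_ (le_add_self.trans' (ENNReal.le_tsum η))))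
  rw [htop, ENNReal.mul_top (by simpa [tabooKernel, hη] using hp)]

lemma tabooPotential_ne_top (hb : tabooPotential p w b b ≠ ∞) {n : ℕ} {η : E}
    (hη : killedPower p 1 n b η ≠ 0) : tabooPotential p w b η ≠ ∞ := by
  classical
  induction n generalizing η with
  | zero =>
    rw [killedPower_zero, ne_eq, ite_eq_right_iff, Classical.not_imp] at hη
    exact hη.1 ▸ hb
  | succ n ih =>
    obtain rfl | hηb := eq_or_ne η b
    · exact hb
    rw [killedPower_succ, Pi.one_apply, mul_one, ne_eq, ENNReal.tsum_eq_zero, not_forall] at hη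
    obtain ⟨ζ, hζ⟩ := hη
    exact tabooPotential_ne_top_of_step (ih (left_ne_zero_of_mul hζ)) hηb
      (right_ne_zero_of_mul hζ)

end Taboo

/-! ### Uniqueness of Laplace transforms -/

section Laplace

open Complex Topology in
lemma measure_eq_of_eqOn_mgf {m₁ m₂ : Measure ℝ} [IsFiniteMeasure m₁] [IsFiniteMeasure m₂]
    {U : Set ℝ} (hU : IsOpen U) (hconv : Convex ℝ U) (h0 : 0 ∈ U)
    (h₁ : U ⊆ integrableExpSet id m₁) (h₂ : U ⊆ integrableExpSet id m₂)
    (h : EqOn (mgf id m₁) (mgf id m₂) U) : m₁ = m₂ := by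
  have hanalytic (m : Measure ℝ) (hm : U ⊆ integrableExpSet id m) :
      AnalyticOnNhd ℂ (complexMGF id m) (re ⁻¹' U) :=
    analyticOnNhd_complexMGF.mono fun _ hz => interior_maximal hm hU hz
  have hreal : ∃ᶠ z in 𝓝[≠] (0 : ℂ), complexMGF id m₁ z = complexMGF id m₂ z := by
    have hcoe : Tendsto ((↑) : ℝ → ℂ) (𝓝[≠] 0) (𝓝[≠] 0) :=
      tendsto_nhdsWithin_of_tendsto_nhds_of_eventually_within _
        (continuous_ofReal.tendsto' 0 0 ofReal_zero |>.mono_left nhdsWithin_le_nhds)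
        (eventually_mem_nhdsWithin.mono fun t ht => ofReal_ne_zero.2 ht)
    refine hcoe.frequently (Eventually.frequently ?_)
    filter_upwards [nhdsWithin_le_nhds (hU.mem_nhds h0)] with t ht
    rw [complexMGF_ofReal, complexMGF_ofReal, h ht]
  have heq : EqOn (complexMGF id m₁) (complexMGF id m₂) (re ⁻¹' U) :=
    (hanalytic m₁ h₁).eqOn_of_preconnected_of_frequently_eq (hanalytic m₂ h₂)
      (hconv.linear_preimage reLm).isPreconnected (by simpa using h0) hreal
  refine Measure.ext_of_charFun (funext fun t => ?_)
  rw [← complexMGF_id_mul_I, ← complexMGF_id_mul_I, heq (by simpa using h0)]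

/-- The Laplace transform of a nonnegative function on `(0, ∞)`. -/
def laplace (f : ℝ → ℝ≥0∞) (b : ℝ) : ℝ≥0∞ :=
  ∫⁻ t in Ioi 0, ENNReal.ofReal (Real.exp (-(b * t))) * f t

/-- The measure on `(0, ∞)` with density `exp (-t) * f t`, which turns a Laplace transform that is
finite on `(0, ∞)` into the moment generating function of a finite measure. -/
def tiltedMeasure (f : ℝ → ℝ≥0∞) : Measure ℝ :=
  (volume.restrict (Ioi 0)).withDensity fun t => ENNReal.ofReal (Real.exp (-t)) * f t

variable {f g : ℝ → ℝ≥0∞}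

lemma isFiniteMeasure_tiltedMeasure (hfin : laplace f 1 ≠ ∞) :
    IsFiniteMeasure (tiltedMeasure f) :=
  isFiniteMeasure_withDensity (by simpa [laplace] using hfin)

lemma lintegral_exp_mul_tiltedMeasure (hf : Measurable f) (u : ℝ) :
    ∫⁻ t, ENNReal.ofReal (Real.exp (u * t)) ∂tiltedMeasure f = laplace f (1 - u) := by
  rw [tiltedMeasure, lintegral_withDensity_eq_lintegral_mul _ (by fun_prop) (by fun_prop)]
  refine lintegral_congr fun t => ?_
  rw [Pi.mul_apply, mul_right_comm, ← ENNReal.ofReal_mul (Real.exp_pos _).le, ← Real.exp_add]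
  ring_nf

lemma mgf_tiltedMeasure (hf : Measurable f) (u : ℝ) :
    mgf id (tiltedMeasure f) u = (laplace f (1 - u)).toReal := by
  rw [← lintegral_exp_mul_tiltedMeasure hf, mgf,
    integral_eq_lintegral_of_nonneg_ae (.of_forall fun _ => (Real.exp_pos _).le) (by fun_prop)]
  rfl

lemma Iio_subset_integrableExpSet_tiltedMeasure (hf : Measurable f)
    (hfin : ∀ b : ℝ, 0 < b → laplace f b ≠ ∞) :
    Iio 1 ⊆ integrableExpSet id (tiltedMeasure f) := by
  intro u hu
  refine ⟨by fun_prop, ?_⟩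
  rw [hasFiniteIntegral_iff_ofReal (.of_forall fun _ => (Real.exp_pos _).le)]
  exact lt_top_iff_ne_top.2
    (lintegral_exp_mul_tiltedMeasure hf u ▸ hfin _ (sub_pos.2 (mem_Iio.1 hu)))

lemma ae_eq_of_laplace_eq (hf : Measurable f) (hg : Measurable g)
    (hfin : ∀ b : ℝ, 0 < b → laplace f b ≠ ∞)
    (h : ∀ b : ℝ, 0 < b → laplace f b = laplace g b) : f =ᵐ[volume.restrict (Ioi 0)] g := by
  have hgfin (b : ℝ) (hb : 0 < b) : laplace g b ≠ ∞ := h b hb ▸ hfin b hb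
  have := isFiniteMeasure_tiltedMeasure (hfin 1 one_pos)
  have := isFiniteMeasure_tiltedMeasure (hgfin 1 one_pos)
  have htilted : tiltedMeasure f = tiltedMeasure g :=
    measure_eq_of_eqOn_mgf isOpen_Iio (convex_Iio 1) (mem_Iio.2 one_pos)
      (Iio_subset_integrableExpSet_tiltedMeasure hf hfin)
      (Iio_subset_integrableExpSet_tiltedMeasure hg hgfin)
      fun u hu => by rw [mgf_tiltedMeasure hf, mgf_tiltedMeasure hg, h _ (sub_pos.2 hu)]
  have hdensity := (withDensity_eq_iff (by fun_prop) (by fun_prop)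
    (by simpa [laplace] using hfin 1 one_pos)).1 htilted
  filter_upwards [hdensity] with t ht
  exact (ENNReal.mul_right_inj (by simpa using Real.exp_pos _) ENNReal.ofReal_ne_top).1 ht

end Laplace

/-! ### The jump chain and its exponential clocks -/

namespace RateMatrix

variable {E : Type*} (R : RateMatrix E)

/-- The jump probabilities as a matrix with entries in `ℝ≥0∞`. -/
def jumpMatrix (η ξ : E) : ℝ≥0∞ := R.jumpPMF η ξ

lemma tsum_jumpMatrix (η : E) : ∑' ξ, R.jumpMatrix η ξ = 1 := (R.jumpPMF η).tsum_coe

variable [Countable E] [MeasurableSpace E] [DiscreteMeasurableSpace E]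

instance (η : E) : IsProbabilityMeasure (R.chainLaw η) := by
  unfold chainLaw
  infer_instance

lemma ae_chainLaw_zero (η : E) : ∀ᵐ y ∂(R.chainLaw η), y 0 = η := by
  have hstart : (R.chainLaw η).map (Preorder.frestrictLe 0)
      = Measure.dirac (fun _ : Finset.Iic 0 => η) := by
    rw [chainLaw, Kernel.traj_map_frestrictLe_apply, Kernel.partialTraj_self, Kernel.id_apply]
  have hmap : ∀ᵐ x ∂((R.chainLaw η).map (Preorder.frestrictLe 0)),
      x ⟨0, Finset.mem_Iic.2 le_rfl⟩ = η := by
    rw [hstart, ae_dirac_iff (measurableSet_eq_fun (measurable_pi_apply _) measurable_const)]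
  exact ae_of_ae_map (Measurable.aemeasurable (by fun_prop)) hmap

lemma lintegral_jumpKernel (η : E) (g : E → ℝ≥0∞) :
    ∫⁻ ζ, g ζ ∂(R.jumpKernel η) = ∑' ζ, R.jumpMatrix η ζ * g ζ := by
  rw [lintegral_countable']
  refine tsum_congr fun ζ => ?_
  rw [mul_comm]
  congr 1
  exact (R.jumpPMF η).toMeasure_apply_singleton ζ (measurableSet_singleton ζ)

lemma lintegral_chainLaw_restrict_succ (η : E) (n : ℕ)
    (Φ : ((i : Finset.Iic n) → E) → E → ℝ≥0∞) :
    ∫⁻ y, Φ (fun i => y i) (y (n + 1)) ∂(R.chainLaw η)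
      = ∫⁻ y, ∑' ζ, R.jumpMatrix (y n) ζ * Φ (fun i => y i) ζ ∂(R.chainLaw η) := by
  have hΦ : Measurable (Function.uncurry Φ) := .of_discrete
  have hlaw := Kernel.partialTraj_compProd_eq_map_traj (X := fun _ : ℕ => E) (κ := R.stepKernel)
    (Nat.zero_le n) (x₀ := fun _ => η)
  have hint := congrArg (fun m => ∫⁻ x, Function.uncurry Φ x ∂m) hlaw
  rw [lintegral_map hΦ (by fun_prop), Measure.lintegral_compProd hΦ,
    ← Kernel.traj_map_frestrictLe_apply, lintegral_map (by fun_prop) (by fun_prop)] at hint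
  exact hint.symm.trans (lintegral_congr fun y => R.lintegral_jumpKernel (y n) _)

/-- The Markov property of the jump chain at time `n`, for a functional `G` of the path up to time
`n` and of the next state. -/
lemma lintegral_chainLaw_succ (η : E) {n : ℕ} {G : (ℕ → E) → E → ℝ≥0∞} (hG : DependsOn G (Iic n)) :
    ∫⁻ y, G y (y (n + 1)) ∂(R.chainLaw η)
      = ∫⁻ y, ∑' ζ, R.jumpMatrix (y n) ζ * G y ζ ∂(R.chainLaw η) := by
  have hpast (y : ℕ → E) : G y = G fun i => y (min i n) :=
    hG fun i hi => by rw [min_eq_left (mem_Iic.1 hi)]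
  have h := R.lintegral_chainLaw_restrict_succ η n
    fun x => G fun i => x ⟨min i n, Finset.mem_Iic.2 (min_le_right i n)⟩
  simpa only [← hpast] using h

lemma lintegral_chainLaw_prod_mul (z : E → ℝ≥0∞) (η : E) (n : ℕ) (g : E → ℝ≥0∞) :
    ∫⁻ y, (∏ i ∈ Finset.range (n + 1), z (y i)) * g (y n) ∂(R.chainLaw η)
      = ∑' ξ, killedPower R.jumpMatrix z n η ξ * g ξ := by
  induction n generalizing g with
  | zero =>
    have hstart : ∀ᵐ y ∂(R.chainLaw η),
        (∏ i ∈ Finset.range (0 + 1), z (y i)) * g (y 0) = z η * g η := by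
      filter_upwards [R.ae_chainLaw_zero η] with y hy
      simp [hy]
    rw [lintegral_congr_ae hstart]
    simp [killedPower_zero]
  | succ n ih =>
    have hG : DependsOn (fun (y : ℕ → E) ζ =>
        (∏ i ∈ Finset.range (n + 1), z (y i)) * (z ζ * g ζ)) (Iic n) := fun y y' h => by
      have hprod : ∏ i ∈ Finset.range (n + 1), z (y i) = ∏ i ∈ Finset.range (n + 1), z (y' i) :=
        Finset.prod_congr rfl fun i hi => by
          rw [h i (mem_Iic.2 (Nat.lt_succ_iff.1 (Finset.mem_range.1 hi)))]
      simp only [hprod]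
    calc ∫⁻ y, (∏ i ∈ Finset.range (n + 1 + 1), z (y i)) * g (y (n + 1)) ∂(R.chainLaw η)
        = ∫⁻ y, (∏ i ∈ Finset.range (n + 1), z (y i))
            * ∑' ζ, R.jumpMatrix (y n) ζ * (z ζ * g ζ) ∂(R.chainLaw η) := by
          simp only [Finset.prod_range_succ _ (n + 1), mul_assoc]
          rw [R.lintegral_chainLaw_succ η hG]
          simp only [mul_left_comm (R.jumpMatrix _ _), ENNReal.tsum_mul_left]
      _ = ∑' ξ, killedPower R.jumpMatrix z (n + 1) η ξ * g ξ := by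
          rw [ih fun x => ∑' ζ, R.jumpMatrix x ζ * (z ζ * g ζ)]
          simp only [killedPower_succ, ← ENNReal.tsum_mul_left, ← ENNReal.tsum_mul_right]
          rw [ENNReal.tsum_comm]
          exact tsum_congr fun ζ => tsum_congr fun θ => by ring

lemma chainLaw_apply_eq (n : ℕ) (η ξ : E) :
    R.chainLaw η {y | y n = ξ} = killedPower R.jumpMatrix 1 n η ξ := by
  classical
  have hξ : MeasurableSet {y : ℕ → E | y n = ξ} :=
    measurableSet_eq_fun (measurable_pi_apply n) measurable_const
  have h := R.lintegral_chainLaw_prod_mul 1 η n (({ξ} : Set E).indicator 1)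
  rw [← lintegral_indicator_one hξ]
  simpa [indicator_apply] using h

variable {R}

lemma ChainRecurrent.green_eq_top (hrec : R.ChainRecurrent) (η : E) :
    green R.jumpMatrix 1 η η = ∞ := by
  by_contra hfin
  simp only [green, ← R.chainLaw_apply_eq] at hfin
  obtain ⟨y, hy, hy'⟩ := ((hrec η).and (ae_eventually_notMem hfin)).exists
  exact hy hy'

lemma ChainIrreducible.exists_killedPower_ne_zero (hirr : R.ChainIrreducible) (η ξ : E) :
    ∃ n, killedPower R.jumpMatrix 1 n η ξ ≠ 0 := by
  by_contra! hzero
  refine (hirr η ξ).ne' ?_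
  rw [ofPred_exists, measure_iUnion_null_iff]
  exact fun n => by rw [R.chainLaw_apply_eq, hzero]

end RateMatrix

section Exponential

instance isProbabilityMeasure_expMeasure_one : IsProbabilityMeasure (expMeasure 1) :=
  isProbabilityMeasure_expMeasure one_pos

lemma expMeasure_one_Ioi {a : ℝ} (ha : 0 ≤ a) :
    expMeasure 1 (Ioi a) = ENNReal.ofReal (Real.exp (-a)) := by
  have hcdf := cdf_expMeasure_eq one_pos a
  rw [if_pos ha, one_mul, cdf_eq_real] at hcdf
  rw [← compl_Iic, ← ofReal_measureReal, probReal_compl_eq_one_sub measurableSet_Iic, hcdf,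
    sub_sub_cancel]

lemma ae_pos_expMeasure_one : ∀ᵐ x ∂(expMeasure 1), 0 < x := by
  have hpos : expMeasure 1 (Ioi 0) = 1 := by simp [expMeasure_one_Ioi]
  exact (mem_ae_iff_prob_eq_one measurableSet_Ioi).2 hpos

lemma lintegral_exp_neg_mul_Ioi {c : ℝ} (hc : 0 < c) (a : ℝ) :
    ∫⁻ t in Ioi a, ENNReal.ofReal (Real.exp (-(c * t)))
      = ENNReal.ofReal (Real.exp (-(c * a)) / c) := by
  have hint := integrableOn_exp_mul_Ioi (neg_lt_zero.2 hc) a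
  have hval := integral_exp_mul_Ioi (neg_lt_zero.2 hc) a
  simp only [neg_mul] at hint hval
  rw [← ofReal_integral_eq_lintegral_ofReal hint (.of_forall fun t => (Real.exp_pos _).le), hval,
    neg_div_neg_eq]

lemma lintegral_expMeasure_one_id : ∫⁻ x, ENNReal.ofReal x ∂(expMeasure 1) = 1 := by
  have htail : ∫⁻ t in Ioi 0, expMeasure 1 {x | t < x}
      = ∫⁻ t in Ioi (0 : ℝ), ENNReal.ofReal (Real.exp (-t)) :=
    setLIntegral_congr_fun measurableSet_Ioi fun t ht => expMeasure_one_Ioi (mem_Ioi.1 ht).le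
  rw [lintegral_eq_lintegral_meas_lt _ (ae_pos_expMeasure_one.mono fun _ => le_of_lt)
    aemeasurable_id, htail]
  simpa using lintegral_exp_neg_mul_Ioi one_pos 0

lemma lintegral_expMeasure_one_exp_neg_mul (c : ℝ≥0) :
    ∫⁻ x, ENNReal.ofReal (Real.exp (-(c * x))) ∂(expMeasure 1) = (1 + (c : ℝ≥0∞))⁻¹ := by
  have hdensity : ∀ x, exponentialPDF 1 x * ENNReal.ofReal (Real.exp (-(c * x)))
      = (Ici 0).indicator (fun x => ENNReal.ofReal (Real.exp (-((1 + c : ℝ) * x)))) x := by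
    intro x
    obtain hx | hx := le_or_gt 0 x
    · rw [indicator_of_mem (mem_Ici.2 hx), exponentialPDF_of_nonneg hx, one_mul,
        ← ENNReal.ofReal_mul (Real.exp_pos _).le, ← Real.exp_add]
      ring_nf
    · rw [indicator_of_notMem (by simpa using hx), exponentialPDF_of_neg hx, zero_mul]
  have hmeas : Measurable (exponentialPDF 1) := (measurable_exponentialPDFReal 1).ennreal_ofReal
  change ∫⁻ x, _ ∂(volume.withDensity (exponentialPDF 1)) = _
  rw [lintegral_withDensity_eq_lintegral_mul _ hmeas (by fun_prop)]
  simp only [Pi.mul_apply, hdensity]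
  rw [lintegral_indicator measurableSet_Ici, ← setLIntegral_congr Ioi_ae_eq_Ici,
    lintegral_exp_neg_mul_Ioi (by positivity), mul_zero, neg_zero, Real.exp_zero, one_div,
    ENNReal.ofReal_inv_of_pos (by positivity), ENNReal.ofReal_add zero_le_one c.coe_nonneg]
  simp

/-- The law of a sequence of i.i.d. mean-one exponential variables. -/
def expSeq : Measure (ℕ → ℝ) := Measure.infinitePi fun _ : ℕ => expMeasure 1

instance : IsProbabilityMeasure expSeq := by
  unfold expSeq
  infer_instance

lemma measurePreserving_eval_expSeq (n : ℕ) :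
    MeasurePreserving (fun e => e n) expSeq (expMeasure 1) :=
  measurePreserving_eval_infinitePi (fun _ : ℕ => expMeasure 1) n

lemma ae_expSeq_pos : ∀ᵐ e ∂expSeq, ∀ n, 0 < e n :=
  ae_all_iff.2 fun n =>
    (measurePreserving_eval_expSeq n).quasiMeasurePreserving.ae ae_pos_expMeasure_one

lemma lintegral_expSeq_exp_neg_sum (c : ℕ → ℝ≥0) (n : ℕ) :
    ∫⁻ e, ENNReal.ofReal (Real.exp (-∑ i ∈ Finset.range n, c i * e i)) ∂expSeq
      = ∏ i ∈ Finset.range n, discount c i := by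
  set X : ℕ → ℝ → ℝ≥0∞ := fun i x => ENNReal.ofReal (Real.exp (-(c i * x)))
  have hXm (i : ℕ) : Measurable (X i) := by fun_prop
  have hprod (e : ℕ → ℝ) : ENNReal.ofReal (Real.exp (-∑ i ∈ Finset.range n, c i * e i))
      = ∏ i ∈ Finset.range n, X i (e i) := by
    rw [← ENNReal.ofReal_prod_of_nonneg fun i _ => (Real.exp_pos _).le, ← Real.exp_sum,
      Finset.sum_neg_distrib]
  simp only [hprod]
  have hindep : iIndepFun (fun i (e : ℕ → ℝ) => X i (e i)) expSeq := iIndepFun_infinitePi hXm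
  refine (lintegral_prod_eq_prod_lintegral_of_indepFun (Finset.range n) _ hindep
    fun i => (hXm i).comp (measurable_pi_apply i)).trans ?_
  exact Finset.prod_congr rfl fun i _ => by
    rw [(measurePreserving_eval_expSeq i).lintegral_comp (hXm i),
      lintegral_expMeasure_one_exp_neg_mul, discount]

lemma lintegral_expSeq_sum_succ (c : ℕ → ℝ≥0) (n : ℕ) {f : ℝ → ℝ → ℝ≥0∞}
    (hf : Measurable (Function.uncurry f)) :
    ∫⁻ e, f (∑ i ∈ Finset.range n, c i * e i) (c n * e n) ∂expSeq
      = ∫⁻ e, ∫⁻ x, f (∑ i ∈ Finset.range n, c i * e i) (c n * x) ∂(expMeasure 1) ∂expSeq := by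
  have hterm (i : ℕ) : Measurable fun e : ℕ → ℝ => c i * e i := by fun_prop
  have hsum : Measurable fun e : ℕ → ℝ => ∑ i ∈ Finset.range n, c i * e i :=
    Finset.measurable_sum _ fun i _ => hterm i
  have hiIndep : iIndepFun (fun i (e : ℕ → ℝ) => c i * e i) expSeq :=
    iIndepFun_infinitePi (X := fun i x => (c i : ℝ) * x) fun i => by fun_prop
  have hindep : IndepFun (fun e : ℕ → ℝ => ∑ i ∈ Finset.range n, c i * e i)
      (fun e => c n * e n) expSeq := by
    simpa only [Finset.sum_fn] using hiIndep.indepFun_sum_range_succ hterm n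
  have hprod := hindep.map_prod_eq_prod_map_map hsum.aemeasurable (hterm n).aemeasurable
  have hint := congrArg (fun m => ∫⁻ x, Function.uncurry f x ∂m) hprod
  rw [lintegral_map hf (hsum.prodMk (hterm n)), lintegral_prod _ hf.aemeasurable,
    lintegral_map hf.lintegral_prod_right' hsum] at hint
  simp only [Function.uncurry_apply_pair] at hint
  rw [hint]
  refine lintegral_congr fun e => ?_
  rw [lintegral_map (by fun_prop) (by fun_prop)]
  exact (measurePreserving_eval_expSeq n).lintegral_comp (f := fun x => f _ (c n * x)) (by fun_prop)

end Exponential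

/-! ### Transition functions -/

section Clock

variable {E : Type*} (w : E → ℝ≥0)

/-- The time elapsed before the `n`-th jump when state `ξ` is held for `w ξ` times an exponential
variable. -/
def clock (n : ℕ) (ω : (ℕ → E) × (ℕ → ℝ)) : ℝ :=
  ∑ i ∈ Finset.range n, (w (ω.1 i) : ℝ) * ω.2 i

/-- The event that at time `t` the chain has made `n` jumps and sits in `ξ`. -/
def occupied (ξ : E) (t : ℝ) (n : ℕ) : Set ((ℕ → E) × (ℕ → ℝ)) :=
  {ω | ω.1 n = ξ ∧ t ∈ Ico (clock w n ω) (clock w (n + 1) ω)}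

variable {ω : (ℕ → E) × (ℕ → ℝ)}

lemma clock_zero : clock w 0 ω = 0 := rfl

lemma clock_succ (n : ℕ) : clock w (n + 1) ω = clock w n ω + w (ω.1 n) * ω.2 n :=
  Finset.sum_range_succ _ _

lemma clock_mono (hω : ∀ n, 0 < ω.2 n) : Monotone fun n => clock w n ω :=
  monotone_nat_of_le_succ fun n => by
    rw [clock_succ]
    exact le_add_of_nonneg_right (mul_nonneg (w _).coe_nonneg (hω n).le)

lemma clock_nonneg (hω : ∀ n, 0 < ω.2 n) (n : ℕ) : 0 ≤ clock w n ω :=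
  clock_mono w hω (Nat.zero_le n)

variable {w}

lemma clock_lt_clock_succ (hω : ∀ n, 0 < ω.2 n) {n : ℕ} (hn : w (ω.1 n) ≠ 0) :
    clock w n ω < clock w (n + 1) ω := by
  rw [clock_succ]
  exact lt_add_of_pos_right _ (mul_pos (by positivity) (hω n))

lemma ne_zero_of_mem_Ico_clock {n : ℕ} {t : ℝ} (ht : t ∈ Ico (clock w n ω) (clock w (n + 1) ω)) :
    w (ω.1 n) ≠ 0 := fun hzero => by
  rw [clock_succ, hzero, NNReal.coe_zero, zero_mul, add_zero, Ico_self] at ht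
  exact ht

lemma index_eq_of_mem_Ico_clock (hω : ∀ n, 0 < ω.2 n) {t : ℝ} {m n : ℕ}
    (hm : t ∈ Ico (clock w m ω) (clock w (m + 1) ω))
    (hn : t ∈ Ico (clock w n ω) (clock w (n + 1) ω)) : m = n := by
  by_contra hmn
  exact ((clock_mono w hω).pairwise_disjoint_on_Ico_succ hmn).notMem_of_mem_left hm hn

lemma exists_mem_Ico_clock (hω : ∀ n, 0 < ω.2 n) (hunbdd : ¬ BddAbove (range fun n => clock w n ω))
    {t : ℝ} (ht : 0 ≤ t) : ∃ n, t ∈ Ico (clock w n ω) (clock w (n + 1) ω) := by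
  have hcover := iUnion_Ico_map_succ_eq_Ici (f := fun n => clock w n ω)
    (fun n => clock_nonneg w hω n) hunbdd
  exact mem_iUnion.1 (hcover.symm ▸ mem_Ici.2 ht)

lemma mem_iUnion_occupied_iff (hω : ∀ n, 0 < ω.2 n) {n : ℕ} {t : ℝ}
    (ht : t ∈ Ico (clock w n ω) (clock w (n + 1) ω)) (ξ : E) :
    ω ∈ ⋃ n, occupied w ξ t n ↔ ω.1 n = ξ := by
  refine ⟨fun h => ?_, fun h => mem_iUnion.2 ⟨n, h, ht⟩⟩
  obtain ⟨m, hstate, hm⟩ := mem_iUnion.1 h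
  exact index_eq_of_mem_Ico_clock hω hm ht ▸ hstate

variable [MeasurableSpace E] [DiscreteMeasurableSpace E]

@[fun_prop]
lemma measurable_clock (n : ℕ) : Measurable (clock w n) := by
  have hw : Measurable w := .of_discrete
  unfold clock
  fun_prop

variable [Countable E]

lemma measurableSet_setOf_occupied (ξ : E) (n : ℕ) :
    MeasurableSet {x : ℝ × ((ℕ → E) × (ℕ → ℝ)) | x.2 ∈ occupied w ξ x.1 n} := by
  have hstate : Measurable fun x : ℝ × ((ℕ → E) × (ℕ → ℝ)) => x.2.1 n := by fun_prop
  have hclock (k : ℕ) : Measurable fun x : ℝ × ((ℕ → E) × (ℕ → ℝ)) => clock w k x.2 := by fun_prop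
  exact (hstate (measurableSet_singleton ξ)).inter
    ((measurableSet_le (hclock n) measurable_fst).inter
      (measurableSet_lt measurable_fst (hclock (n + 1))))

lemma measurableSet_occupied (ξ : E) (t : ℝ) (n : ℕ) : MeasurableSet (occupied w ξ t n) :=
  measurable_prodMk_left (measurableSet_setOf_occupied ξ n)

end Clock

section HoldProb

variable {a : ℝ≥0}

/-- The probability that a state entered at time `s`, with mean holding time `a`, is still occupied
at time `t`. -/
def holdProb (a : ℝ≥0) (t s : ℝ) : ℝ≥0∞ :=
  if s ≤ t then ENNReal.ofReal (Real.exp (-((t - s) / a))) else 0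

@[fun_prop]
lemma measurable_holdProb : Measurable (Function.uncurry (holdProb a)) :=
  Measurable.ite (measurableSet_le measurable_snd measurable_fst) (by fun_prop) measurable_const

lemma expMeasure_one_mem_Ico (ha : a ≠ 0) (t s : ℝ) :
    expMeasure 1 {x | t ∈ Ico s (s + a * x)} = holdProb a t s := by
  have ha' : (0 : ℝ) < a := by positivity
  unfold holdProb
  split_ifs with hst
  · have hset : {x : ℝ | t ∈ Ico s (s + a * x)} = Ioi ((t - s) / a) := by
      ext x
      rw [mem_ofPred_eq, mem_Ioi, div_lt_iff₀ ha', mem_Ico, sub_lt_iff_lt_add', mul_comm]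
      exact and_iff_right hst
    rw [hset, expMeasure_one_Ioi (div_nonneg (sub_nonneg.2 hst) ha'.le)]
  · simp [hst]

lemma expSeq_mem_Ico_sum {c : ℕ → ℝ≥0} {n : ℕ} (hc : c n ≠ 0) (t : ℝ) :
    expSeq {e | t ∈ Ico (∑ i ∈ Finset.range n, c i * e i) (∑ i ∈ Finset.range (n + 1), c i * e i)}
      = ∫⁻ e, holdProb (c n) t (∑ i ∈ Finset.range n, c i * e i) ∂expSeq := by
  have hset : MeasurableSet {x : ℝ × ℝ | t ∈ Ico x.1 (x.1 + x.2)} :=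
    (measurableSet_le measurable_fst measurable_const).inter
      (measurableSet_lt measurable_const (measurable_fst.add measurable_snd))
  have hpair : Measurable fun e : ℕ → ℝ => (∑ i ∈ Finset.range n, c i * e i, c n * e n) := by
    fun_prop
  have h := lintegral_expSeq_sum_succ c n
    (f := fun s x => {x : ℝ × ℝ | t ∈ Ico x.1 (x.1 + x.2)}.indicator 1 (s, x))
    (measurable_one.indicator hset)
  simp only [Finset.sum_range_succ _ n]
  refine (lintegral_indicator_one (hpair hset)).symm.trans (h.trans (lintegral_congr fun e => ?_))
  rw [← expMeasure_one_mem_Ico hc]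
  exact lintegral_indicator_one (measurable_const.prodMk (measurable_id.const_mul _) hset)

lemma holdProb_mul_le (a : ℝ≥0) {s t r : ℝ} (hst : s ≤ t) :
    holdProb a s r * ENNReal.ofReal (Real.exp (-((t - s) / a))) ≤ holdProb a t r := by
  unfold holdProb
  split_ifs with hrs hrt hrt
  · rw [← ENNReal.ofReal_mul (Real.exp_pos _).le, ← Real.exp_add, ← neg_add, ← add_div,
      sub_add_sub_cancel']
  · exact absurd (hrs.trans hst) hrt
  · simp
  · simp

lemma laplace_holdProb (ha : a ≠ 0) (b : ℝ≥0) {s : ℝ} (hs : 0 ≤ s) :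
    laplace (fun t => holdProb a t s) b
      = ENNReal.ofReal (Real.exp (-(b * s))) * (a * (1 + (b * a : ℝ≥0∞))⁻¹) := by
  have ha' : (0 : ℝ) < a := by positivity
  have hab : (0 : ℝ) < b + 1 / a := by positivity
  have hshift (t : ℝ) : ENNReal.ofReal (Real.exp (-(b * t))) * holdProb a t s
      = (Ici s).indicator (fun t => ENNReal.ofReal (Real.exp (s / a))
        * ENNReal.ofReal (Real.exp (-((b + 1 / a) * t)))) t := by
    unfold holdProb
    split_ifs with hst
    · rw [indicator_of_mem (mem_Ici.2 hst), ← ENNReal.ofReal_mul (Real.exp_pos _).le,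
        ← ENNReal.ofReal_mul (Real.exp_pos _).le, ← Real.exp_add, ← Real.exp_add]
      congr 2
      field_simp
      ring
    · rw [indicator_of_notMem (by simpa using hst), mul_zero]
  have hmean : (a : ℝ≥0∞) * (1 + (b * a : ℝ≥0∞))⁻¹ = ENNReal.ofReal (1 / (b + 1 / a)) := by
    have hdiv : 1 / ((b : ℝ) + 1 / a) = a * (1 + b * a : ℝ)⁻¹ := by
      field_simp
      ring
    rw [hdiv, ENNReal.ofReal_mul ha'.le, ENNReal.ofReal_inv_of_pos (by positivity),
      ENNReal.ofReal_add zero_le_one (by positivity), ENNReal.ofReal_mul b.coe_nonneg]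
    simp
  simp only [laplace, hshift]
  rw [setLIntegral_congr Ioi_ae_eq_Ici, lintegral_indicator measurableSet_Ici,
    Measure.restrict_restrict measurableSet_Ici, Ici_inter_Ici, sup_of_le_left hs,
    ← setLIntegral_congr Ioi_ae_eq_Ici, lintegral_const_mul _ (by fun_prop),
    lintegral_exp_neg_mul_Ioi hab, hmean, ← ENNReal.ofReal_mul (Real.exp_pos _).le,
    ← ENNReal.ofReal_mul (Real.exp_pos _).le, ← mul_div_assoc, ← Real.exp_add, mul_one_div]
  congr 3
  ring

end HoldProb

namespace RateMatrix

variable {E : Type*} (R : RateMatrix E)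
variable [Countable E] [MeasurableSpace E] [DiscreteMeasurableSpace E]

lemma law_eq (η : E) : R.law η = (R.chainLaw η).prod expSeq := rfl

instance (η : E) : IsProbabilityMeasure (R.law η) := by
  rw [law_eq]
  infer_instance

lemma ae_law_fst {η : E} {P : (ℕ → E) → Prop} (h : ∀ᵐ y ∂(R.chainLaw η), P y) :
    ∀ᵐ ω ∂(R.law η), P ω.1 :=
  Measure.quasiMeasurePreserving_fst.ae h

lemma ae_law_pos (η : E) : ∀ᵐ ω ∂(R.law η), ∀ n, 0 < ω.2 n :=
  Measure.quasiMeasurePreserving_snd.ae ae_expSeq_pos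

lemma ae_law_zero (η : E) : ∀ᵐ ω ∂(R.law η), ω.1 0 = η := R.ae_law_fst (R.ae_chainLaw_zero η)

variable (w : E → ℝ≥0)

lemma law_occupied (η : E) {ξ : E} (hξ : w ξ ≠ 0) (t : ℝ) (n : ℕ) :
    R.law η (occupied w ξ t n)
      = ∫⁻ ω, ({ξ} : Set E).indicator 1 (ω.1 n) * holdProb (w ξ) t (clock w n ω) ∂(R.law η) := by
  have hind : Measurable (({ξ} : Set E).indicator (1 : E → ℝ≥0∞)) := .of_discrete
  rw [law_eq, Measure.prod_apply (measurableSet_occupied ξ t n),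
    lintegral_prod _ (by fun_prop)]
  refine lintegral_congr fun y => ?_
  by_cases hy : y n = ξ
  · have h := expSeq_mem_Ico_sum (c := fun i => w (y i)) (n := n) (by rwa [hy]) t
    simpa [hy, occupied, clock] using h
  · simp [hy, occupied]

lemma law_occupied_mul_le (η : E) {ξ : E} (hξ : w ξ ≠ 0) {s t : ℝ} (hst : s ≤ t) (n : ℕ) :
    R.law η (occupied w ξ s n) * ENNReal.ofReal (Real.exp (-((t - s) / w ξ)))
      ≤ R.law η (occupied w ξ t n) := by
  rw [R.law_occupied w η hξ, R.law_occupied w η hξ,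
    ← lintegral_mul_const' _ _ ENNReal.ofReal_ne_top]
  refine lintegral_mono fun ω => ?_
  simp only [mul_assoc]
  gcongr
  exact holdProb_mul_le _ hst

lemma laplace_law_occupied_eq_lintegral (η : E) {ξ : E} (hξ : w ξ ≠ 0) (b : ℝ≥0) (n : ℕ) :
    laplace (fun t => R.law η (occupied w ξ t n)) b
      = ∫⁻ ω, ({ξ} : Set E).indicator 1 (ω.1 n) * (w ξ * discount (b • w) ξ)
          * ENNReal.ofReal (Real.exp (-(b * clock w n ω))) ∂(R.law η) := by
  have hind : Measurable (({ξ} : Set E).indicator (1 : E → ℝ≥0∞)) := .of_discrete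
  have : Measurable fun x : ℝ × ((ℕ → E) × (ℕ → ℝ)) => holdProb (w ξ) x.1 (clock w n x.2) :=
    measurable_holdProb.comp (measurable_fst.prodMk ((measurable_clock n).comp measurable_snd))
  have hswap : laplace (fun t => R.law η (occupied w ξ t n)) b
      = ∫⁻ ω, (∫⁻ t in Ioi (0 : ℝ), ENNReal.ofReal (Real.exp (-(b * t)))
        * (({ξ} : Set E).indicator 1 (ω.1 n) * holdProb (w ξ) t (clock w n ω))) ∂(R.law η) := by
    simp only [laplace, R.law_occupied w η hξ, ← lintegral_const_mul' _ _ ENNReal.ofReal_ne_top]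
    exact lintegral_lintegral_swap (Measurable.aemeasurable (by fun_prop))
  rw [hswap]
  refine lintegral_congr_ae ?_
  filter_upwards [R.ae_law_pos η] with ω hω
  have hlap := laplace_holdProb hξ b (clock_nonneg w hω n)
  have hind_ne_top : ({ξ} : Set E).indicator (1 : E → ℝ≥0∞) (ω.1 n) ≠ ∞ := by
    by_cases h : ω.1 n = ξ <;> simp [h]
  simp only [mul_left_comm (ENNReal.ofReal _)]
  rw [lintegral_const_mul' _ _ hind_ne_top]
  simp only [laplace] at hlap
  rw [hlap, discount]
  simp only [Pi.smul_apply, smul_eq_mul, ENNReal.coe_mul]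
  ring

lemma lintegral_law_mul_exp_neg_clock (η : E) (b : ℝ≥0) (n : ℕ) (g : E → ℝ≥0∞) :
    ∫⁻ ω, g (ω.1 n) * ENNReal.ofReal (Real.exp (-(b * clock w n ω))) ∂(R.law η)
      = ∫⁻ y, g (y n) * ∏ i ∈ Finset.range n, discount (b • w) (y i) ∂(R.chainLaw η) := by
  have hg : Measurable g := .of_discrete
  rw [law_eq, lintegral_prod _ (by fun_prop)]
  refine lintegral_congr fun y => ?_
  have hclock (e : ℕ → ℝ) : ∑ i ∈ Finset.range n, (((b • w) (y i) : ℝ≥0) : ℝ) * e i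
      = b * clock w n (y, e) := by simp [clock, Finset.mul_sum, mul_assoc]
  have h := lintegral_expSeq_exp_neg_sum (fun i => (b • w) (y i)) n
  simp only [hclock] at h
  exact (lintegral_const_mul (g (y n)) (by fun_prop)).trans (congrArg (g (y n) * ·) h)

lemma laplace_law_occupied (η : E) {ξ : E} (hξ : w ξ ≠ 0) (b : ℝ≥0) (n : ℕ) :
    laplace (fun t => R.law η (occupied w ξ t n)) b
      = killedPower R.jumpMatrix (discount (b • w)) n η ξ * w ξ := by
  classical
  have hind (y : ℕ → E) : ({ξ} : Set E).indicator 1 (y n) * (w ξ * discount (b • w) ξ)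
        * ∏ i ∈ Finset.range n, discount (b • w) (y i)
      = (∏ i ∈ Finset.range (n + 1), discount (b • w) (y i))
        * ({ξ} : Set E).indicator (fun ζ => (w ζ : ℝ≥0∞)) (y n) := by
    obtain hy | hy := eq_or_ne (y n) ξ
    · simp only [hy, mem_singleton_iff, indicator_of_mem, Pi.one_apply, Finset.prod_range_succ]
      ring
    · simp [hy]
  rw [R.laplace_law_occupied_eq_lintegral w η hξ,
    R.lintegral_law_mul_exp_neg_clock w η b n
      fun ζ => ({ξ} : Set E).indicator 1 ζ * (w ξ * discount (b • w) ξ)]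
  simp only [hind]
  rw [R.lintegral_chainLaw_prod_mul, tsum_eq_single ξ fun ζ hζ => by simp [hζ]]
  simp

end RateMatrix

section RealAnalysis

open Topology

lemma frequently_nhdsWithin_of_ae {P : ℝ → Prop} {U : Set ℝ} {t : ℝ} (hU : IsOpen U)
    (h : ∀ᵐ s ∂(volume.restrict U), P s) (ht : t ∈ closure U) : ∃ᶠ s in 𝓝[U] t, P s := by
  have hdense : Dense {s | s ∈ U → P s} :=
    Measure.dense_of_ae ((ae_restrict_iff' hU.measurableSet).1 h)
  have hmem : t ∈ closure (U ∩ {s | s ∈ U → P s}) :=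
    closure_minimal (hdense.open_subset_closure_inter hU) isClosed_closure ht
  rw [frequently_nhdsWithin_iff]
  exact (mem_closure_iff_frequently.1 hmem).mono fun s hs => ⟨hs.2 hs.1, hs.1⟩

lemma eq_of_ae_eq_of_tendsto_nhdsGT {f g : ℝ → ℝ≥0∞} (h : f =ᵐ[volume.restrict (Ioi 0)] g) {t : ℝ}
    (ht : 0 ≤ t) (hf : Tendsto f (𝓝[>] t) (𝓝 (f t))) (hg : Tendsto g (𝓝[>] t) (𝓝 (g t))) :
    f t = g t :=
  tendsto_nhds_unique_of_frequently_eq hf hg <|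
    frequently_nhdsWithin_of_ae isOpen_Ioi (ae_restrict_of_ae_restrict_of_subset
      (Ioi_subset_Ioi ht) h) (by simp)

lemma eq_of_ae_eq_const_of_mul_exp_le {f : ℝ → ℝ≥0∞} {c : ℝ≥0∞} {a : ℝ}
    (hf : ∀ s t, s ≤ t → f s * ENNReal.ofReal (Real.exp (-((t - s) / a))) ≤ f t)
    (h : f =ᵐ[volume.restrict (Ioi 0)] fun _ => c) {t : ℝ} (ht : 0 < t) : f t = c := by
  have hlim {φ : ℝ → ℝ} (hφ : Continuous φ) (hφt : φ t = 0) (x : ℝ≥0∞) (U : Set ℝ) :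
      Tendsto (fun s => x * ENNReal.ofReal (Real.exp (-(φ s / a)))) (𝓝[U] t) (𝓝 x) := by
    have hexp := ENNReal.tendsto_ofReal
      (((hφ.div_const a).neg.rexp.tendsto t).mono_left (nhdsWithin_le_nhds (s := U)))
    simpa [hφt] using ENNReal.Tendsto.const_mul (a := x) hexp
      (Or.inl (by simpa using Real.exp_pos _))
  have hafter : ∃ᶠ s in 𝓝[>] t, f s = c := frequently_nhdsWithin_of_ae isOpen_Ioi
    (ae_restrict_of_ae_restrict_of_subset (Ioi_subset_Ioi ht.le) h) (by simp)
  have hbefore : ∃ᶠ s in 𝓝[Ioo 0 t] t, f s = c := frequently_nhdsWithin_of_ae isOpen_Ioo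
    (ae_restrict_of_ae_restrict_of_subset Ioo_subset_Ioi_self h)
    (by simp [closure_Ioo ht.ne, ht.le])
  refine le_antisymm ?_ ?_
  · refine le_of_tendsto_of_frequently (hlim (φ := fun s => s - t) (by fun_prop) (by simp) _ _)
      ((hafter.and_eventually eventually_mem_nhdsWithin).mono fun s hs => ?_)
    exact (hf t s (mem_Ioi.1 hs.2).le).trans_eq hs.1
  · refine le_of_tendsto_of_frequently (hlim (φ := fun s => t - s) (by fun_prop) (by simp) c _)
      ((hbefore.and_eventually eventually_mem_nhdsWithin).mono fun s hs => ?_)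
    have hle := hf s t hs.2.2.le
    rwa [hs.1] at hle

end RealAnalysis

section LaplaceRules

variable {f : ℝ → ℝ≥0∞}

lemma laplace_const_mul (hf : Measurable f) (c : ℝ≥0∞) (b : ℝ) :
    laplace (fun t => c * f t) b = c * laplace f b := by
  simp only [laplace, mul_left_comm _ c]
  exact lintegral_const_mul _ (by fun_prop)

lemma laplace_tsum {ι : Type*} [Countable ι] {f : ι → ℝ → ℝ≥0∞} (hf : ∀ i, Measurable (f i))
    (b : ℝ) : laplace (fun t => ∑' i, f i t) b = ∑' i, laplace (f i) b := by
  simp only [laplace, ← ENNReal.tsum_mul_left]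
  exact lintegral_tsum fun i => by have := hf i; fun_prop

lemma laplace_const (c : ℝ≥0∞) {b : ℝ} (hb : 0 < b) :
    laplace (fun _ => c) b = (ENNReal.ofReal b)⁻¹ * c := by
  rw [laplace, lintegral_mul_const _ (by fun_prop), lintegral_exp_neg_mul_Ioi hb, mul_zero,
    neg_zero, Real.exp_zero, one_div, ENNReal.ofReal_inv_of_pos hb]

end LaplaceRules

section Clock

lemma exists_prod_le_pow {c : ℕ → ℝ≥0∞} {a : ℝ≥0∞} (hc : ∀ n, c n ≤ 1)
    (h : ∃ᶠ n in atTop, c n = a) (k : ℕ) : ∃ N, ∏ i ∈ Finset.range N, c i ≤ a ^ k := by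
  induction k with
  | zero => exact ⟨0, by simp⟩
  | succ k ih =>
    obtain ⟨N, hN⟩ := ih
    obtain ⟨n, hn, hna⟩ := frequently_atTop.1 h N
    refine ⟨n + 1, ?_⟩
    rw [Finset.prod_range_succ, hna, pow_succ, ← Finset.prod_range_mul_prod_Ico _ hn]
    gcongr
    exact (mul_le_of_le_one_right' (Finset.prod_le_one' fun i _ => hc i)).trans hN

variable {E : Type*} {w : E → ℝ≥0}

/-- The expectation of `exp (-clock w n)` tends to zero because a factor `discount w η` is gained
at each visit to `η`. -/
lemma ae_not_bddAbove_clock {y : ℕ → E} {η : E} (hη : w η ≠ 0) (hy : ∃ᶠ n in atTop, y n = η) :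
    ∀ᵐ e ∂expSeq, ¬ BddAbove (range fun n => clock w n (y, e)) := by
  set L : (ℕ → ℝ) → ℝ≥0∞ := fun e => ⨅ n, ENNReal.ofReal (Real.exp (-clock w n (y, e)))
  have hclock (n : ℕ) : Measurable fun e : ℕ → ℝ => ∑ i ∈ Finset.range n, (w (y i) : ℝ) * e i := by
    fun_prop
  have hLm : Measurable L := .iInf fun n => (hclock n).neg.exp.ennreal_ofReal
  have hle (n : ℕ) : ∫⁻ e, L e ∂expSeq ≤ ∏ i ∈ Finset.range n, discount w (y i) := by
    refine le_of_le_of_eq (lintegral_mono fun e => iInf_le _ n) ?_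
    exact lintegral_expSeq_exp_neg_sum (fun i => w (y i)) n
  have hlt : discount w η < 1 := by
    rw [discount, ENNReal.inv_lt_one]
    exact ENNReal.lt_add_right ENNReal.one_ne_top (by simpa using hη)
  have hzero : ∫⁻ e, L e ∂expSeq = 0 := by
    refine le_antisymm (ge_of_tendsto' (ENNReal.tendsto_pow_atTop_nhds_zero_of_lt_one hlt)
      fun k => ?_) zero_le
    obtain ⟨N, hN⟩ := exists_prod_le_pow (c := fun i => discount w (y i))
      (fun n => by simp [discount]) (hy.mono fun n hn => congrArg (discount w) hn) k
    exact (hle N).trans hN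
  filter_upwards [(lintegral_eq_zero_iff hLm).1 hzero] with e he ⟨t, ht⟩
  have hbound : ENNReal.ofReal (Real.exp (-t)) ≤ L e := le_iInf fun n =>
    ENNReal.ofReal_le_ofReal (Real.exp_le_exp.2 (neg_le_neg (ht (mem_range_self n))))
  rw [he, Pi.zero_apply, nonpos_iff_eq_zero, ENNReal.ofReal_eq_zero] at hbound
  exact hbound.not_gt (Real.exp_pos _)

end Clock

namespace RateMatrix

variable {E : Type*} (R : RateMatrix E)
variable [Countable E] [MeasurableSpace E] [DiscreteMeasurableSpace E]
variable {w : E → ℝ≥0}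

variable {R} in
lemma ChainRecurrent.ae_not_bddAbove_clock (hrec : R.ChainRecurrent) {η : E} (hη : w η ≠ 0) :
    ∀ᵐ ω ∂(R.law η), ¬ BddAbove (range fun n => clock w n ω) := by
  have hmeas : MeasurableSet {ω : (ℕ → E) × (ℕ → ℝ) | ¬ BddAbove (range fun n => clock w n ω)} :=
    (measurableSet_bddAbove_range measurable_clock).compl
  rw [law_eq, Measure.ae_prod_iff_ae_ae hmeas]
  exact (hrec η).mono fun y hy => _root_.ae_not_bddAbove_clock hη hy

variable (w) in
/-- The transition function of the process that follows the jump chain and holds state `ζ` for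
`w ζ` times an exponential variable: the probability of sitting in `ξ` at time `t`, from `η`. -/
def transition (η ξ : E) (t : ℝ) : ℝ≥0∞ := ∑' n, R.law η (occupied w ξ t n)

lemma measurable_law_occupied (η ξ : E) (n : ℕ) :
    Measurable fun t => R.law η (occupied w ξ t n) :=
  measurable_measure_prodMk_left (measurableSet_setOf_occupied ξ n)

@[fun_prop]
lemma measurable_transition (η ξ : E) : Measurable (R.transition w η ξ) :=
  Measurable.tsum fun n => R.measurable_law_occupied η ξ n

lemma law_iUnion_occupied (η ξ : E) (t : ℝ) :
    R.law η (⋃ n, occupied w ξ t n) = R.transition w η ξ t := by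
  refine measure_iUnion₀ (fun m n hmn => ?_)
    fun n => (measurableSet_occupied ξ t n).nullMeasurableSet
  refine measure_mono_null (t := {ω | ¬ ∀ n, 0 < ω.2 n}) ?_ (R.ae_law_pos η)
  exact fun ω hmem hω => hmn (index_eq_of_mem_Ico_clock hω hmem.1.2 hmem.2.2)

lemma law_eq_transition (hrec : R.ChainRecurrent) {η : E} (hη : w η ≠ 0) {t : ℝ} (ht : 0 ≤ t)
    {X : (ℕ → E) × (ℕ → ℝ) → E} (hX : ∀ᵐ ω ∂(R.law η), ∀ n,
      t ∈ Ico (clock w n ω) (clock w (n + 1) ω) → X ω = ω.1 n) (ξ : E) :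
    R.law η {ω | X ω = ξ} = R.transition w η ξ t := by
  rw [← law_iUnion_occupied]
  refine measure_congr ?_
  filter_upwards [hX, hrec.ae_not_bddAbove_clock hη, R.ae_law_pos η] with ω hX hunbdd hpos
  refine propext ⟨fun h => ?_, fun h => ?_⟩
  · obtain ⟨n, hn⟩ := exists_mem_Ico_clock hpos hunbdd ht
    exact mem_iUnion.2 ⟨n, (hX n hn).symm.trans h, hn⟩
  · obtain ⟨n, hstate, hn⟩ := mem_iUnion.1 h
    exact (hX n hn).trans hstate

lemma transition_le_one (η ξ : E) (t : ℝ) : R.transition w η ξ t ≤ 1 :=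
  R.law_iUnion_occupied η ξ t ▸ prob_le_one

lemma transition_mul_le (η : E) {ξ : E} (hξ : w ξ ≠ 0) {s t : ℝ} (hst : s ≤ t) :
    R.transition w η ξ s * ENNReal.ofReal (Real.exp (-((t - s) / w ξ)))
      ≤ R.transition w η ξ t := by
  unfold transition
  rw [← ENNReal.tsum_mul_right]
  exact ENNReal.tsum_le_tsum fun n => R.law_occupied_mul_le w η hξ hst n

lemma laplace_transition (η : E) {ξ : E} (hξ : w ξ ≠ 0) (b : ℝ≥0) :
    laplace (R.transition w η ξ) b = green R.jumpMatrix (discount (b • w)) η ξ * w ξ := by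
  unfold transition green
  rw [laplace_tsum fun n => R.measurable_law_occupied η ξ n, ← ENNReal.tsum_mul_right]
  exact tsum_congr fun n => R.laplace_law_occupied w η hξ b n

open Topology in
lemma tendsto_transition (hrec : R.ChainRecurrent) {η : E} (hη : w η ≠ 0) (ξ : E) {t : ℝ}
    (ht : 0 ≤ t) : Tendsto (R.transition w η ξ) (𝓝[>] t) (𝓝 (R.transition w η ξ t)) := by
  have hm (s : ℝ) : MeasurableSet (⋃ n, occupied w ξ s n) :=
    .iUnion fun n => measurableSet_occupied ξ s n
  rw [← funext (R.law_iUnion_occupied (w := w) η ξ)]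
  refine tendsto_measure_of_ae_tendsto_indicator_of_isFiniteMeasure _ (hm t) hm ?_
  filter_upwards [hrec.ae_not_bddAbove_clock hη, R.ae_law_pos η] with ω hunbdd hpos
  obtain ⟨n, hn⟩ := exists_mem_Ico_clock hpos hunbdd ht
  filter_upwards [Ioo_mem_nhdsGT hn.2] with s hs
  rw [mem_iUnion_occupied_iff hpos hn, mem_iUnion_occupied_iff hpos ⟨hn.1.trans hs.1.le, hs.2⟩]

open Classical in
lemma transition_zero {η : E} (hη : w η ≠ 0) (ξ : E) :
    R.transition w η ξ 0 = if η = ξ then 1 else 0 := by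
  have hiff : ∀ᵐ ω ∂(R.law η), (ω ∈ ⋃ n, occupied w ξ 0 n ↔ η = ξ) := by
    filter_upwards [R.ae_law_pos η, R.ae_law_zero η] with ω hpos hzero
    have hmem : 0 ∈ Ico (clock w 0 ω) (clock w (0 + 1) ω) := by
      rw [clock_succ, clock_zero, hzero, zero_add]
      exact ⟨le_rfl, mul_pos (by positivity) (hpos 0)⟩
    rw [mem_iUnion_occupied_iff hpos hmem, hzero]
  rw [← law_iUnion_occupied]
  split_ifs with h
  · exact (measure_congr (eventuallyEq_univ.2 (hiff.mono fun ω hω => hω.2 h))).trans measure_univ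
  · exact measure_eq_zero_iff_ae_notMem.2 (hiff.mono fun ω hω hmem => h (hω.1 hmem))

end RateMatrix

/-! ### Balance equations in discrete and continuous time -/

namespace RateMatrix

variable {E : Type*} (R : RateMatrix E)
variable [Countable E] [MeasurableSpace E] [DiscreteMeasurableSpace E]
variable {w : E → ℝ≥0} {σ : E → ℝ≥0∞}

lemma laplace_transition_one (η : E) {ξ : E} (hξ : w ξ ≠ 0) :
    laplace (R.transition w η ξ) 1 = green R.jumpMatrix (discount w) η ξ * w ξ := by
  simpa using R.laplace_transition η hξ 1

lemma laplace_transition_ne_top (η ξ : E) {b : ℝ} (hb : 0 < b) :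
    laplace (R.transition w η ξ) b ≠ ∞ := by
  have hle : laplace (R.transition w η ξ) b ≤ laplace (fun _ => 1) b :=
    lintegral_mono fun t => mul_le_mul_right (R.transition_le_one η ξ t) _
  rw [laplace_const 1 hb, mul_one] at hle
  exact ne_top_of_le_ne_top (by simpa using hb) hle

lemma green_discount_ne_top (η : E) {ξ : E} (hξ : w ξ ≠ 0) :
    green R.jumpMatrix (discount w) η ξ ≠ ∞ := fun htop =>
  R.laplace_transition_ne_top η ξ one_pos (w := w) <| by
    rw [R.laplace_transition_one η hξ, htop, ENNReal.top_mul (by exact_mod_cast hξ)]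

lemma laplace_tsum_mul_transition (c : E → ℝ≥0∞) {ξ : E} (hξ : w ξ ≠ 0) (b : ℝ≥0) :
    laplace (fun t => ∑' η, c η * R.transition w η ξ t) b
      = potential R.jumpMatrix (discount (b • w)) c ξ * w ξ := by
  rw [laplace_tsum (fun η => by fun_prop), potential, ← ENNReal.tsum_mul_right]
  exact tsum_congr fun η => by
    rw [laplace_const_mul (by fun_prop), R.laplace_transition η hξ, mul_assoc]

lemma globalBalance_of_transition (hw : ∀ ξ, w ξ ≠ 0) (hσ : ∀ ξ, σ ξ ≠ ∞)
    (h : ∀ t, 0 ≤ t → ∀ ξ, ∑' η, σ η * w η * R.transition w η ξ t = σ ξ * w ξ) :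
    GlobalBalance R.jumpMatrix σ := by
  refine globalBalance_of_potential_discount _ w hσ fun ξ => ?_
  have hflow : laplace (fun t => ∑' η, σ η * w η * R.transition w η ξ t) 1 = σ ξ * w ξ := by
    have hconst := laplace_const (σ ξ * w ξ) one_pos
    rw [ENNReal.ofReal_one, inv_one, one_mul] at hconst
    rw [← hconst]
    exact setLIntegral_congr_fun measurableSet_Ioi fun t ht => by
      simp only [h t (mem_Ioi.1 ht).le]
  have hlap := R.laplace_tsum_mul_transition (fun η => σ η * w η) (hw ξ) 1
  rw [NNReal.coe_one, hflow, one_smul] at hlap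
  exact ((ENNReal.mul_left_inj (by exact_mod_cast hw ξ) ENNReal.coe_ne_top).1 hlap).symm

lemma laplace_flow_of_globalBalance (hrec : R.ChainRecurrent) (hσ : ∀ ξ, σ ξ ≠ ∞)
    (h : GlobalBalance R.jumpMatrix σ) {ξ : E} (hξ : w ξ ≠ 0) {b : ℝ} (hb : 0 < b) :
    laplace (fun t => ∑' η, σ η * w η * R.transition w η ξ t) b
      = laplace (fun _ => σ ξ * w ξ) b := by
  lift b to ℝ≥0 using hb.le
  have hb' : (b : ℝ≥0∞) ≠ 0 := by exact_mod_cast hb.ne'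
  have hpot := potential_discount_of_globalBalance R.jumpMatrix (b • w) hrec.green_eq_top hσ h
    (ξ := ξ) (by simpa [hξ] using hb')
  have hcharge (η : E) : σ η * ((b • w) η : ℝ≥0) = b * (σ η * w η) := by
    rw [Pi.smul_apply, smul_eq_mul, ENNReal.coe_mul, mul_left_comm]
  simp only [hcharge, potential, mul_assoc (b : ℝ≥0∞), ENNReal.tsum_mul_left] at hpot
  rw [R.laplace_tsum_mul_transition _ hξ, laplace_const _ hb, ENNReal.ofReal_coe_nnreal, ← hpot,
    mul_assoc, ← mul_assoc, ENNReal.inv_mul_cancel hb' ENNReal.coe_ne_top, one_mul]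
  rfl

lemma tsum_mul_transition_of_globalBalance (hrec : R.ChainRecurrent) (hσ : ∀ ξ, σ ξ ≠ ∞)
    (h : GlobalBalance R.jumpMatrix σ) {ξ : E} (hξ : w ξ ≠ 0) {t : ℝ} (ht : 0 ≤ t) :
    ∑' η, σ η * w η * R.transition w η ξ t = σ ξ * w ξ := by
  obtain rfl | ht := ht.eq_or_lt
  · classical
    refine (tsum_eq_single ξ fun η hη => ?_).trans
      (by rw [R.transition_zero hξ, if_pos rfl, mul_one])
    obtain hw | hw := eq_or_ne (w η) 0
    · simp [hw]
    · rw [R.transition_zero hw, if_neg hη, mul_zero]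
  have hloss (s t : ℝ) (hst : s ≤ t) : (∑' η, σ η * w η * R.transition w η ξ s)
      * ENNReal.ofReal (Real.exp (-((t - s) / w ξ))) ≤ ∑' η, σ η * w η * R.transition w η ξ t := by
    rw [← ENNReal.tsum_mul_right]
    refine ENNReal.tsum_le_tsum fun η => ?_
    rw [mul_assoc]
    gcongr
    exact R.transition_mul_le η hξ hst
  have hlap (b : ℝ) (hb : 0 < b) := R.laplace_flow_of_globalBalance hrec hσ h hξ hb
  refine eq_of_ae_eq_const_of_mul_exp_le
    (f := fun t => ∑' η, σ η * w η * R.transition w η ξ t) hloss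
    (ae_eq_of_laplace_eq (Measurable.tsum fun η => by fun_prop) measurable_const
      (fun b hb => ?_) hlap) ht
  rw [hlap b hb, laplace_const _ hb]
  exact ENNReal.mul_ne_top (by simpa using hb) (ENNReal.mul_ne_top (hσ ξ) ENNReal.coe_ne_top)

lemma detailedBalance_of_transition (hw : ∀ ξ, w ξ ≠ 0) (hσ : ∀ ξ, σ ξ ≠ ∞)
    (h : ∀ t, 0 ≤ t → DetailedBalance (fun η ξ => R.transition w η ξ t) fun η => σ η * w η) :
    DetailedBalance R.jumpMatrix σ := by
  have hlap (η ξ : E) : laplace (fun t => σ η * w η * R.transition w η ξ t) 1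
      = σ η * green R.jumpMatrix (discount w) η ξ * (w η * w ξ) := by
    rw [laplace_const_mul (by fun_prop), R.laplace_transition_one η (hw ξ)]
    ring
  refine detailedBalance_of_green (discount_ne_zero w) (discount_ne_top w) hσ
    (fun η ξ => R.green_discount_ne_top η (hw ξ)) fun η ξ => ?_
  have hsymm : laplace (fun t => σ η * w η * R.transition w η ξ t) 1
      = laplace (fun t => σ ξ * w ξ * R.transition w ξ η t) 1 :=
    setLIntegral_congr_fun measurableSet_Ioi fun t ht => by
      simp only [h t (mem_Ioi.1 ht).le η ξ]
  rw [hlap, hlap, mul_comm (w ξ : ℝ≥0∞)] at hsymm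
  exact (ENNReal.mul_left_inj (by simp [hw]) (by finiteness)).1 hsymm

lemma mul_transition_of_detailedBalance (hrec : R.ChainRecurrent) (hσ : ∀ ξ, σ ξ ≠ ∞)
    (h : DetailedBalance R.jumpMatrix σ) {η ξ : E} (hη : w η ≠ 0) (hξ : w ξ ≠ 0) {t : ℝ}
    (ht : 0 ≤ t) : σ η * w η * R.transition w η ξ t = σ ξ * w ξ * R.transition w ξ η t := by
  have hfin (ζ : E) : σ ζ * w ζ ≠ ∞ := ENNReal.mul_ne_top (hσ ζ) ENNReal.coe_ne_top
  refine eq_of_ae_eq_of_tendsto_nhdsGT (f := fun t => σ η * w η * R.transition w η ξ t)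
    (g := fun t => σ ξ * w ξ * R.transition w ξ η t)
    (ae_eq_of_laplace_eq (by fun_prop) (by fun_prop) (fun b hb => ?_) fun b hb => ?_) ht
    (ENNReal.Tendsto.const_mul (R.tendsto_transition hrec hη ξ ht) (Or.inr (hfin η)))
    (ENNReal.Tendsto.const_mul (R.tendsto_transition hrec hξ η ht) (Or.inr (hfin ξ)))
  · rw [laplace_const_mul (by fun_prop)]
    exact ENNReal.mul_ne_top (hfin η) (R.laplace_transition_ne_top η ξ hb)
  · lift b to ℝ≥0 using hb.le
    have hgreen := detailedBalance_green h (z := discount (b • w)) η ξ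
    rw [laplace_const_mul (by fun_prop), laplace_const_mul (by fun_prop),
      R.laplace_transition η hξ, R.laplace_transition ξ hη]
    calc _ = σ η * green R.jumpMatrix (discount (b • w)) η ξ * (w η * w ξ) := by ring
      _ = _ := by rw [hgreen]; ring

end RateMatrix

/-! ### The process and its trace -/

namespace RateMatrix

variable {E : Type*} (R : RateMatrix E)

/-- The mean holding time `1 / λ(η)`. -/
def holdMean (η : E) : ℝ≥0 := Real.toNNReal (R.holdingRate η)⁻¹

/-- The mean time collected by the additive functional of `h` during one visit to `η`, hence the
mean time the `h`-trace then spends in `η`. -/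
def traceMean (h : E → ℝ≥0) (η : E) : ℝ≥0 := h η * R.holdMean η

lemma coe_holdMean (η : E) : (R.holdMean η : ℝ) = (R.holdingRate η)⁻¹ :=
  Real.coe_toNNReal _ (inv_nonneg.2 (R.holdingRate_pos η).le)

lemma holdMean_ne_zero (η : E) : R.holdMean η ≠ 0 :=
  (Real.toNNReal_pos.2 (inv_pos.2 (R.holdingRate_pos η))).ne'

lemma traceMean_ne_zero_iff {h : E → ℝ≥0} {η : E} : R.traceMean h η ≠ 0 ↔ h η ≠ 0 := by
  simp [traceMean, R.holdMean_ne_zero]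

section Path

variable {ω : (ℕ → E) × (ℕ → ℝ)} {n : ℕ}

lemma clock_holdMean (n : ℕ) (ω : (ℕ → E) × (ℕ → ℝ)) :
    clock R.holdMean n ω = ∑ i ∈ Finset.range n, R.holdingTime ω i :=
  Finset.sum_congr rfl fun i _ => by rw [holdingTime, coe_holdMean, div_eq_inv_mul]

lemma clock_traceMean_succ (h : E → ℝ≥0) (n : ℕ) (ω : (ℕ → E) × (ℕ → ℝ)) :
    clock (R.traceMean h) (n + 1) ω
      = clock (R.traceMean h) n ω + h (ω.1 n) * (R.holdMean (ω.1 n) * ω.2 n) := by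
  rw [clock_succ, traceMean, NNReal.coe_mul, mul_assoc]

lemma process_eq_of_mem_Ico_clock (hω : ∀ n, 0 < ω.2 n) {t : ℝ}
    (ht : t ∈ Ico (clock R.holdMean n ω) (clock R.holdMean (n + 1) ω)) :
    R.process t ω = ω.1 n := by
  unfold process jumpIndex
  simp only [← R.clock_holdMean]
  refine congrArg ω.1 (le_antisymm (Nat.sInf_le ht.2) (le_csInf ⟨n, ht.2⟩ fun k hk => ?_))
  by_contra! hkn
  exact (mem_ofPred_eq ▸ hk).not_ge ((clock_mono R.holdMean hω hkn).trans ht.1)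

variable {h : E → ℝ≥0}

lemma additiveFunctional_add (hω : ∀ n, 0 < ω.2 n) {r : ℝ} (hr₀ : 0 ≤ r)
    (hr : r ≤ R.holdMean (ω.1 n) * ω.2 n) :
    R.additiveFunctional h (clock R.holdMean n ω + r) ω
      = R.additiveFunctional h (clock R.holdMean n ω) ω + ENNReal.ofReal (h (ω.1 n) * r) := by
  have hvisit : ∫⁻ s in Ioc (clock R.holdMean n ω) (clock R.holdMean n ω + r),
      (h (R.process s ω) : ℝ≥0∞) = ENNReal.ofReal (h (ω.1 n) * r) := by
    have hstate : ∀ s ∈ Ico (clock R.holdMean n ω) (clock R.holdMean n ω + r),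
        (h (R.process s ω) : ℝ≥0∞) = h (ω.1 n) := fun s hs => by
      rw [R.process_eq_of_mem_Ico_clock hω ⟨hs.1, hs.2.trans_le ?_⟩]
      rw [clock_succ]
      gcongr
    rw [← setLIntegral_congr Ico_ae_eq_Ioc, setLIntegral_congr_fun measurableSet_Ico hstate,
      setLIntegral_const, Real.volume_Ico, add_sub_cancel_left,
      ENNReal.ofReal_mul (NNReal.coe_nonneg _), ENNReal.ofReal_coe_nnreal]
  unfold additiveFunctional
  rw [← hvisit, ← lintegral_union measurableSet_Ioc (Ioc_disjoint_Ioc_of_le le_rfl),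
    Ioc_union_Ioc_eq_Ioc (clock_nonneg _ hω n) (le_add_of_nonneg_right hr₀)]

lemma additiveFunctional_clock_add (hω : ∀ n, 0 < ω.2 n) {r : ℝ} (hr₀ : 0 ≤ r)
    (hr : r ≤ R.holdMean (ω.1 n) * ω.2 n) :
    R.additiveFunctional h (clock R.holdMean n ω + r) ω
      = ENNReal.ofReal (clock (R.traceMean h) n ω + h (ω.1 n) * r) := by
  have hclock : R.additiveFunctional h (clock R.holdMean n ω) ω
      = ENNReal.ofReal (clock (R.traceMean h) n ω) := by
    clear hr
    induction n with
    | zero => simp [clock_zero, additiveFunctional]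
    | succ n ih =>
      have hvisit : 0 ≤ R.holdMean (ω.1 n) * ω.2 n := mul_nonneg (NNReal.coe_nonneg _) (hω n).le
      rw [clock_succ, R.additiveFunctional_add hω hvisit le_rfl, ih, clock_traceMean_succ,
        ENNReal.ofReal_add (clock_nonneg _ hω n) (by positivity)]
  rw [R.additiveFunctional_add hω hr₀ hr, hclock,
    ENNReal.ofReal_add (clock_nonneg _ hω n) (by positivity)]

/-- The additive functional grows at the positive rate `h (ω.1 n)` during the `n`-th visit, so its
generalized inverse is there a true inverse. -/
lemma inverseFunctional_clock_add (hω : ∀ n, 0 < ω.2 n) (hn : h (ω.1 n) ≠ 0) {r : ℝ} (hr₀ : 0 ≤ r)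
    (hr : r < R.holdMean (ω.1 n) * ω.2 n) :
    R.inverseFunctional h (clock (R.traceMean h) n ω + h (ω.1 n) * r) ω
      = clock R.holdMean n ω + r := by
  have hpos : (0 : ℝ) < h (ω.1 n) := by positivity
  have hclock := clock_nonneg (R.traceMean h) hω n
  refine IsGreatest.csSup_eq ⟨⟨add_nonneg (clock_nonneg _ hω n) hr₀,
    (R.additiveFunctional_clock_add hω hr₀ hr.le).le⟩, fun s hs => ?_⟩
  by_contra! hlt
  obtain ⟨u, hru, hu⟩ := exists_between (lt_min (lt_sub_iff_add_lt'.2 hlt) hr)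
  have hus : clock R.holdMean n ω + u ≤ s := by linarith [hu.trans_le (min_le_left _ _)]
  have hle : R.additiveFunctional h (clock R.holdMean n ω + u) ω
      ≤ ENNReal.ofReal (clock (R.traceMean h) n ω + h (ω.1 n) * r) :=
    (lintegral_mono_set (Ioc_subset_Ioc_right hus)).trans hs.2
  rw [R.additiveFunctional_clock_add hω (hr₀.trans hru.le) (hu.le.trans (min_le_right _ _)),
    ENNReal.ofReal_le_ofReal_iff (by positivity), add_le_add_iff_left,
    mul_le_mul_iff_right₀ hpos] at hle
  exact hle.not_gt hru

lemma trace_eq_of_mem_Ico_clock (hω : ∀ n, 0 < ω.2 n) {t : ℝ}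
    (ht : t ∈ Ico (clock (R.traceMean h) n ω) (clock (R.traceMean h) (n + 1) ω)) :
    R.trace h t ω = ω.1 n := by
  have hn : h (ω.1 n) ≠ 0 := R.traceMean_ne_zero_iff.1 (ne_zero_of_mem_Ico_clock ht)
  have hpos : (0 : ℝ) < h (ω.1 n) := by positivity
  rw [clock_traceMean_succ, mem_Ico] at ht
  obtain ⟨r, rfl⟩ : ∃ r, t = clock (R.traceMean h) n ω + h (ω.1 n) * r :=
    ⟨(t - clock (R.traceMean h) n ω) / h (ω.1 n), by field_simp; ring⟩
  have hr₀ : 0 ≤ r := nonneg_of_mul_nonneg_right (le_add_iff_nonneg_right _ |>.1 ht.1) hpos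
  have hr : r < R.holdMean (ω.1 n) * ω.2 n :=
    lt_of_mul_lt_mul_left (lt_of_add_lt_add_left ht.2) hpos.le
  rw [trace, R.inverseFunctional_clock_add hω hn hr₀ hr]
  refine R.process_eq_of_mem_Ico_clock hω ⟨le_add_of_nonneg_right hr₀, ?_⟩
  rw [clock_succ]
  gcongr

end Path

variable [Countable E] [MeasurableSpace E] [DiscreteMeasurableSpace E]

lemma law_process_eq (hrec : R.ChainRecurrent) (η ξ : E) {t : ℝ} (ht : 0 ≤ t) :
    R.law η {ω | R.process t ω = ξ} = R.transition R.holdMean η ξ t := by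
  refine R.law_eq_transition hrec (R.holdMean_ne_zero η) ht ?_ ξ
  filter_upwards [R.ae_law_pos η] with ω hω n hn
  exact R.process_eq_of_mem_Ico_clock hω hn

variable {h : E → ℝ≥0} {η : E}

lemma law_trace_eq (hrec : R.ChainRecurrent) (hη : h η ≠ 0) (ξ : E) {t : ℝ} (ht : 0 ≤ t) :
    R.law η {ω | R.trace h t ω = ξ} = R.transition (R.traceMean h) η ξ t := by
  refine R.law_eq_transition hrec (R.traceMean_ne_zero_iff.2 hη) ht ?_ ξ
  filter_upwards [R.ae_law_pos η] with ω hω n hn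
  exact R.trace_eq_of_mem_Ico_clock hω hn

lemma ae_not_bddAbove_trace_eq (hrec : R.ChainRecurrent) (hη : h η ≠ 0) :
    ∀ᵐ ω ∂(R.law η), ¬ BddAbove {t : ℝ | 0 ≤ t ∧ R.trace h t ω = η} := by
  have hmean := R.traceMean_ne_zero_iff.2 hη
  filter_upwards [R.ae_law_pos η, hrec.ae_not_bddAbove_clock hmean, R.ae_law_fst (hrec η)]
    with ω hpos hunbdd hfreq
  rw [not_bddAbove_iff]
  intro M
  obtain ⟨_, ⟨m, rfl⟩, hm⟩ := not_bddAbove_iff.1 hunbdd M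
  obtain ⟨n, hmn, hn⟩ := frequently_atTop.1 hfreq m
  have hvisit : clock (R.traceMean h) n ω < clock (R.traceMean h) (n + 1) ω :=
    clock_lt_clock_succ hpos (by rwa [hn])
  exact ⟨clock (R.traceMean h) n ω, ⟨clock_nonneg _ hpos n,
    (R.trace_eq_of_mem_Ico_clock hpos ⟨le_rfl, hvisit⟩).trans hn⟩,
    hm.trans_le (clock_mono _ hpos hmn)⟩

lemma ae_apply_trace_ne_zero (hrec : R.ChainRecurrent) (hη : h η ≠ 0) :
    ∀ᵐ ω ∂(R.law η), ∀ t : ℝ, 0 ≤ t → h (R.trace h t ω) ≠ 0 := by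
  have hmean := R.traceMean_ne_zero_iff.2 hη
  filter_upwards [R.ae_law_pos η, hrec.ae_not_bddAbove_clock hmean] with ω hpos hunbdd t ht
  obtain ⟨n, hn⟩ := exists_mem_Ico_clock hpos hunbdd ht
  rw [R.trace_eq_of_mem_Ico_clock hpos hn]
  exact R.traceMean_ne_zero_iff.1 (ne_zero_of_mem_Ico_clock hn)

end RateMatrix

/-! ### Return times -/

section Tour

variable {E : Type*}

open Classical in
/-- The states of the itinerary `l` that the path `y`, visiting them in the given order from time
`1` on, still has to reach at time `n`. -/
def remaining (l : List E) (y : ℕ → E) : ℕ → List E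
  | 0 => l
  | n + 1 => if (remaining l y n).head? = some (y (n + 1)) then (remaining l y n).tail
      else remaining l y n

lemma dependsOn_remaining (l : List E) (n : ℕ) :
    DependsOn (fun y => remaining l y n) (Iic n) := fun y y' h => by
  induction n with
  | zero => rfl
  | succ n ih =>
    simp only [remaining] at ih ⊢
    rw [ih fun i hi => h i (Iic_subset_Iic.2 n.le_succ hi), h (n + 1) (mem_Iic.2 le_rfl)]

lemma exists_visit_of_remaining_ne {b : E} {l : List E} {y : ℕ → E} {n : ℕ}
    (h : remaining (b :: l) y n ≠ b :: l) :
    ∃ k m, 0 < k ∧ k + m = n ∧ y k = b ∧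
      remaining (b :: l) y n = remaining l (fun i => y (k + i)) m := by
  induction n with
  | zero => exact absurd rfl h
  | succ n ih =>
    by_cases hn : remaining (b :: l) y n = b :: l
    · have hvisit : y (n + 1) = b := by
        by_contra hne
        exact h (by simp [remaining, hn, Ne.symm hne])
      exact ⟨n + 1, 0, n.succ_pos, rfl, hvisit, by simp [remaining, hn, hvisit]⟩
    · obtain ⟨k, m, hk, rfl, hvisit, hrem⟩ := ih hn
      exact ⟨k, m + 1, hk, rfl, hvisit, by rw [remaining, hrem]; rfl⟩

lemma exists_round_trip_of_remaining_eq_nil {ξ η : E} {y : ℕ → E} {n : ℕ}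
    (h : remaining [ξ, η] y n = []) : ∃ k j, 0 < k ∧ k < j ∧ j ≤ n ∧ y k = ξ ∧ y j = η := by
  obtain ⟨k, m, hk, hkm, hξ, hrem⟩ := exists_visit_of_remaining_ne (h.trans_ne (by simp))
  obtain ⟨i, j, hi, hij, hη, -⟩ := exists_visit_of_remaining_ne ((hrem.symm.trans h).trans_ne
    (List.cons_ne_nil η []).symm)
  exact ⟨k, k + i, hk, by omega, by omega, hξ, hη⟩

open Classical in
/-- The weight `w` collected at time `n` by a path that stops at the end of the itinerary `l`. -/
def tourWeight (w : E → ℝ≥0∞) (l : List E) (y : ℕ → E) (n : ℕ) : ℝ≥0∞ :=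
  if remaining l y n = [] then 0 else w (y n)

/-- The expected total `tourWeight` from a given starting state: the sum of the expected weights of
the successive legs. -/
def tourPotential (p : E → E → ℝ≥0∞) (w : E → ℝ≥0∞) : List E → E → ℝ≥0∞
  | [], _ => 0
  | b :: l, η => tabooPotential p w b η + tourPotential p w l b

lemma tsum_le_of_add_le {c v : ℕ → ℝ≥0∞} (h : ∀ n, c n + v (n + 1) ≤ v n) :
    ∑' n, c n ≤ v 0 := by
  have hpartial (N : ℕ) : ∑ n ∈ Finset.range N, c n + v N ≤ v 0 := by
    induction N with
    | zero => simp
    | succ N ih =>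
      rw [Finset.sum_range_succ, add_assoc]
      exact (add_le_add_right (h N) _).trans ih
  rw [ENNReal.tsum_eq_iSup_nat]
  exact iSup_le fun N => le_self_add.trans (hpartial N)

open Classical in
lemma tourPotential_cons_eq {p : E → E → ℝ≥0∞} (hp : ∀ η, ∑' ξ, p η ξ = 1) (w : E → ℝ≥0∞) (b : E)
    (l : List E) (η : E) :
    tourPotential p w (b :: l) η
      = w η + ∑' ζ, p η ζ * tourPotential p w (if b = ζ then l else b :: l) ζ := by
  have hstep (ζ : E) : p η ζ * tourPotential p w (if b = ζ then l else b :: l) ζ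
      = tabooKernel p b η ζ * tabooPotential p w b ζ + p η ζ * tourPotential p w l b := by
    obtain rfl | hζ := eq_or_ne ζ b
    · simp [tabooKernel]
    · rw [if_neg hζ.symm, tabooKernel, if_neg hζ, tourPotential, mul_add]
  simp only [hstep]
  rw [ENNReal.tsum_add, ENNReal.tsum_mul_right, hp, one_mul, ← add_assoc, ← tabooPotential_eq]
  rfl

variable [Countable E] [MeasurableSpace E] [DiscreteMeasurableSpace E]

lemma measurable_of_dependsOn_Iic {β : Type*} [MeasurableSpace β] {n : ℕ} {G : (ℕ → E) → β}
    (hG : DependsOn G (Iic n)) : Measurable G := by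
  have hpast : G = (fun x : (i : Finset.Iic n) → E =>
      G fun i => x ⟨min i n, Finset.mem_Iic.2 (min_le_right i n)⟩) ∘ fun y i => y i :=
    funext fun y => hG fun i hi => by simp [min_eq_left (mem_Iic.1 hi)]
  rw [hpast]
  exact Measurable.of_discrete.comp (by fun_prop)

lemma measurable_tourWeight (w : E → ℝ≥0∞) (l : List E) (n : ℕ) :
    Measurable fun y => tourWeight w l y n :=
  measurable_of_dependsOn_Iic (n := n) fun y y' h => by
    simp only [tourWeight, dependsOn_remaining l n h, h n (mem_Iic.2 le_rfl)]

end Tour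

namespace RateMatrix

variable {E : Type*} (R : RateMatrix E)
variable [Countable E] [MeasurableSpace E] [DiscreteMeasurableSpace E]

lemma tsum_lintegral_tourWeight_le (w : E → ℝ≥0∞) (l : List E) (η : E) :
    ∑' n, ∫⁻ y, tourWeight w l y n ∂(R.chainLaw η) ≤ tourPotential R.jumpMatrix w l η := by
  classical
  set V := tourPotential R.jumpMatrix w
  have hstep (n : ℕ) : ∫⁻ y, tourWeight w l y n ∂(R.chainLaw η)
        + ∫⁻ y, V (remaining l y (n + 1)) (y (n + 1)) ∂(R.chainLaw η)
      ≤ ∫⁻ y, V (remaining l y n) (y n) ∂(R.chainLaw η) := by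
    have hG : DependsOn (fun (y : ℕ → E) ζ =>
        V (if (remaining l y n).head? = some ζ then (remaining l y n).tail
          else remaining l y n) ζ) (Iic n) := fun y y' h => by
      simp only [dependsOn_remaining l n h]
    have hmarkov := R.lintegral_chainLaw_succ η hG
    simp only [remaining]
    rw [hmarkov, ← lintegral_add_left (measurable_tourWeight w l n)]
    refine lintegral_mono fun y => ?_
    rcases hrem : remaining l y n with _ | ⟨b, l'⟩
    · simp [tourWeight, hrem, V, tourPotential]
    · simp only [tourWeight, hrem, reduceCtorEq, if_false, List.head?_cons, Option.some_inj,
        List.tail_cons]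
      exact (tourPotential_cons_eq R.tsum_jumpMatrix w b l' (y n)).ge
  have hstart : ∫⁻ y, V (remaining l y 0) (y 0) ∂(R.chainLaw η) = V l η := by
    have hae : ∀ᵐ y ∂(R.chainLaw η), V (remaining l y 0) (y 0) = V l η := by
      filter_upwards [R.ae_chainLaw_zero η] with y hy
      rw [remaining, hy]
    rw [lintegral_congr_ae hae, lintegral_const, measure_univ, mul_one]
  exact hstart ▸ tsum_le_of_add_le hstep

end RateMatrix

lemma ofReal_clock_le_tsum_tourWeight {E : Type*} (w : E → ℝ≥0) {l : List E}
    {ω : (ℕ → E) × (ℕ → ℝ)} (hω : ∀ n, 0 < ω.2 n) {m : ℕ} (hm : ∀ n < m, remaining l ω.1 n ≠ []) :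
    ENNReal.ofReal (clock w m ω)
      ≤ ∑' n, tourWeight (fun ζ => w ζ) l ω.1 n * ENNReal.ofReal (ω.2 n) := by
  refine le_trans (le_of_eq ?_) (ENNReal.sum_le_tsum (Finset.range m))
  rw [clock, ENNReal.ofReal_sum_of_nonneg fun i _ => mul_nonneg (w _).coe_nonneg (hω i).le]
  refine Finset.sum_congr rfl fun i hi => ?_
  rw [tourWeight, if_neg (hm i (Finset.mem_range.1 hi)), ENNReal.ofReal_mul (w _).coe_nonneg,
    ENNReal.ofReal_coe_nnreal]

namespace RateMatrix

variable {E : Type*} (R : RateMatrix E) {h : E → ℝ≥0} {η ξ : E}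

lemma returnTime_trace_le_clock (hne : ξ ≠ η) (hη : h η ≠ 0) (hξ : h ξ ≠ 0)
    {ω : (ℕ → E) × (ℕ → ℝ)} (hω : ∀ n, 0 < ω.2 n) (hstart : ω.1 0 = η) {k j : ℕ} (hk : 0 < k)
    (hkj : k < j) (hyk : ω.1 k = ξ) (hyj : ω.1 j = η) :
    returnTime (R.trace h) η ω ≤ ENNReal.ofReal (clock (R.traceMean h) j ω) := by
  have hmono := clock_mono (R.traceMean h) hω
  have hjump {n : ℕ} (hn : h (ω.1 n) ≠ 0) :
      clock (R.traceMean h) n ω < clock (R.traceMean h) (n + 1) ω :=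
    clock_lt_clock_succ hω (R.traceMean_ne_zero_iff.2 hn)
  have htrace {n : ℕ} (hn : h (ω.1 n) ≠ 0) :
      R.trace h (clock (R.traceMean h) n ω) ω = ω.1 n :=
    R.trace_eq_of_mem_Ico_clock hω ⟨le_rfl, hjump hn⟩
  have hk_pos : 0 < clock (R.traceMean h) k ω :=
    (hjump (n := 0) (by rwa [hstart])).trans_le (hmono hk)
  have hk_lt : clock (R.traceMean h) k ω < clock (R.traceMean h) j ω :=
    (hjump (by rwa [hyk])).trans_le (hmono hkj)
  have htrace_zero : R.trace h 0 ω = η := (htrace (n := 0) (by rwa [hstart])).trans hstart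
  refine iInf₂_le _ ⟨hk_pos.trans hk_lt, (htrace (by rwa [hyj])).trans hyj,
    clock (R.traceMean h) k ω, hk_pos, hk_lt, ?_⟩
  rwa [htrace (by rwa [hyk]), hyk, htrace_zero]

lemma returnTime_trace_le_tsum (hne : ξ ≠ η) (hη : h η ≠ 0) (hξ : h ξ ≠ 0)
    {ω : (ℕ → E) × (ℕ → ℝ)} (hω : ∀ n, 0 < ω.2 n) (hstart : ω.1 0 = η)
    (hunbdd : ¬ BddAbove (range fun n => clock (R.traceMean h) n ω)) :
    returnTime (R.trace h) η ω
      ≤ ∑' n, tourWeight (fun ζ => R.traceMean h ζ) [ξ, η] ω.1 n * ENNReal.ofReal (ω.2 n) := by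
  classical
  by_cases hend : ∃ n, remaining [ξ, η] ω.1 n = []
  · obtain ⟨k, j, hk, hkj, hj, hyk, hyj⟩ :=
      exists_round_trip_of_remaining_eq_nil (Nat.find_spec hend)
    exact (R.returnTime_trace_le_clock hne hη hξ hω hstart hk hkj hyk hyj).trans
      (ofReal_clock_le_tsum_tourWeight _ hω fun n hn => Nat.find_min hend (hn.trans_le hj))
  · push Not at hend
    refine le_top.trans_eq (ENNReal.eq_top_of_forall_nnreal_le fun r => ?_).symm
    obtain ⟨_, ⟨m, rfl⟩, hm⟩ := not_bddAbove_iff.1 hunbdd r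
    rw [← ENNReal.ofReal_coe_nnreal]
    exact (ENNReal.ofReal_le_ofReal hm.le).trans
      (ofReal_clock_le_tsum_tourWeight _ hω fun n _ => hend n)

variable [Countable E] [MeasurableSpace E] [DiscreteMeasurableSpace E]

lemma lintegral_law_mul_exp (η : E) {f : (ℕ → E) → ℝ≥0∞} (hf : Measurable f) (n : ℕ) :
    ∫⁻ ω, f ω.1 * ENNReal.ofReal (ω.2 n) ∂(R.law η) = ∫⁻ y, f y ∂(R.chainLaw η) := by
  have hmean : ∫⁻ e, ENNReal.ofReal (e n) ∂expSeq = 1 :=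
    ((measurePreserving_eval_expSeq n).lintegral_comp ENNReal.measurable_ofReal).trans
      lintegral_expMeasure_one_id
  have hexp : Measurable fun e : ℕ → ℝ => ENNReal.ofReal (e n) := by fun_prop
  rw [← mul_one (∫⁻ y, f y ∂(R.chainLaw η)), ← hmean]
  exact lintegral_prod_mul hf.aemeasurable hexp.aemeasurable

lemma lintegral_returnTime_trace_le (hrec : R.ChainRecurrent) (hne : ξ ≠ η) (hη : h η ≠ 0)
    (hξ : h ξ ≠ 0) : ∫⁻ ω, returnTime (R.trace h) η ω ∂(R.law η)
      ≤ tourPotential R.jumpMatrix (fun ζ => R.traceMean h ζ) [ξ, η] η := by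
  have hmeas (n : ℕ) := measurable_tourWeight (fun ζ => (R.traceMean h ζ : ℝ≥0∞)) [ξ, η] n
  have hterm (n : ℕ) : Measurable fun ω : (ℕ → E) × (ℕ → ℝ) =>
      tourWeight (fun ζ => R.traceMean h ζ) [ξ, η] ω.1 n * ENNReal.ofReal (ω.2 n) :=
    ((hmeas n).comp measurable_fst).mul (by fun_prop)
  calc ∫⁻ ω, returnTime (R.trace h) η ω ∂(R.law η)
      ≤ ∫⁻ ω, ∑' n, tourWeight (fun ζ => R.traceMean h ζ) [ξ, η] ω.1 n
          * ENNReal.ofReal (ω.2 n) ∂(R.law η) := by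
        refine lintegral_mono_ae ?_
        filter_upwards [R.ae_law_pos η, R.ae_law_zero η,
          hrec.ae_not_bddAbove_clock (R.traceMean_ne_zero_iff.2 hη)] with ω hpos hstart hunbdd
        exact R.returnTime_trace_le_tsum hne hη hξ hpos hstart hunbdd
    _ = ∑' n, ∫⁻ y, tourWeight (fun ζ => R.traceMean h ζ) [ξ, η] y n ∂(R.chainLaw η) := by
        rw [lintegral_tsum fun n => (hterm n).aemeasurable]
        exact tsum_congr fun n => R.lintegral_law_mul_exp η (hmeas n) n
    _ ≤ tourPotential R.jumpMatrix (fun ζ => R.traceMean h ζ) [ξ, η] η :=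
        R.tsum_lintegral_tourWeight_le _ _ _

end RateMatrix

/-! ### Measures of the trace process -/

lemma GlobalBalance.tsum_mul_killedPower {E : Type*} {p : E → E → ℝ≥0∞} {σ : E → ℝ≥0∞}
    (hσ : GlobalBalance p σ) (n : ℕ) (ξ : E) : ∑' η, σ η * killedPower p 1 n η ξ = σ ξ := by
  induction n generalizing ξ with
  | zero => rw [tsum_mul_killedPower_zero, Pi.one_apply, mul_one]
  | succ n ih => simp only [tsum_mul_killedPower_succ, ih, hσ ξ, Pi.one_apply, mul_one]

lemma tourPotential_ne_top {E : Type*} {p : E → E → ℝ≥0∞} {w : E → ℝ≥0∞} {l : List E} {η : E}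
    (h : ∀ b ∈ l, ∀ ζ, tabooPotential p w b ζ ≠ ∞) : tourPotential p w l η ≠ ∞ := by
  induction l generalizing η with
  | nil => exact ENNReal.zero_ne_top
  | cons b l ih =>
    exact ENNReal.add_ne_top.2
      ⟨h b List.mem_cons_self η, ih fun c hc => h c (List.mem_cons_of_mem b hc)⟩

namespace RateMatrix

variable {E : Type*} (R : RateMatrix E)

/-- The measure `λ μ`, which the jump chain preserves when the continuous-time chain preserves
`μ`. -/
def jumpMeasure (μ : E → ℝ≥0) (η : E) : ℝ≥0 := μ η / R.holdMean η

variable {μ h : E → ℝ≥0} {η ξ : E}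

lemma jumpMeasure_mul_holdMean (μ : E → ℝ≥0) (η : E) :
    (R.jumpMeasure μ η : ℝ≥0∞) * R.holdMean η = μ η := by
  rw [← ENNReal.coe_mul, jumpMeasure, div_mul_cancel₀ _ (R.holdMean_ne_zero η)]

lemma jumpMeasure_mul_traceMean (μ h : E → ℝ≥0) (η : E) :
    (R.jumpMeasure μ η : ℝ≥0∞) * R.traceMean h η = (h η * μ η : ℝ≥0) := by
  rw [traceMean, ENNReal.coe_mul, mul_left_comm, jumpMeasure_mul_holdMean, ENNReal.coe_mul]

variable [Countable E] [MeasurableSpace E] [DiscreteMeasurableSpace E]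

lemma globalBalance_jumpMeasure (hrec : R.ChainRecurrent)
    (hμ : IsInvariantMeasure R.law R.process univ fun η => μ η) :
    GlobalBalance R.jumpMatrix fun η => R.jumpMeasure μ η := by
  refine R.globalBalance_of_transition R.holdMean_ne_zero (fun _ => ENNReal.coe_ne_top)
    fun t ht ξ => ?_
  simp only [jumpMeasure_mul_holdMean, ← R.law_process_eq hrec _ _ ht]
  rw [← tsum_univ]
  exact hμ.2 t ht ⟨ξ, mem_univ ξ⟩

lemma detailedBalance_jumpMeasure (hrec : R.ChainRecurrent)
    (hμ : IsReversibleMeasure R.law R.process univ fun η => μ η) :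
    DetailedBalance R.jumpMatrix fun η => R.jumpMeasure μ η := by
  refine R.detailedBalance_of_transition R.holdMean_ne_zero (fun _ => ENNReal.coe_ne_top)
    fun t ht η ξ => ?_
  simp only [jumpMeasure_mul_holdMean, ← R.law_process_eq hrec _ _ ht]
  exact hμ.2 t ht ⟨η, mem_univ η⟩ ⟨ξ, mem_univ ξ⟩

variable {R}

lemma ChainIrreducible.ne_zero_of_globalBalance (hirr : R.ChainIrreducible) {σ : E → ℝ≥0∞}
    (hσ : GlobalBalance R.jumpMatrix σ) (hη : σ η ≠ 0) (ξ : E) : σ ξ ≠ 0 := by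
  obtain ⟨n, hn⟩ := hirr.exists_killedPower_ne_zero η ξ
  rw [← hσ.tsum_mul_killedPower n ξ, ne_eq, ENNReal.tsum_eq_zero, not_forall]
  exact ⟨η, mul_ne_zero hη hn⟩

variable (R)

lemma jumpMeasure_ne_zero (hirr : R.ChainIrreducible) (hrec : R.ChainRecurrent)
    (hμ : IsInvariantMeasure R.law R.process univ fun η => μ η) (ξ : E) :
    R.jumpMeasure μ ξ ≠ 0 := by
  obtain ⟨⟨η, _⟩, hη⟩ := Function.ne_iff.1 hμ.1
  have hη' : (R.jumpMeasure μ η : ℝ≥0∞) ≠ 0 := by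
    exact_mod_cast div_ne_zero hη (R.holdMean_ne_zero η)
  exact_mod_cast hirr.ne_zero_of_globalBalance (R.globalBalance_jumpMeasure hrec hμ) hη' ξ

lemma isInvariantMeasure_trace (hrec : R.ChainRecurrent)
    (hσ : GlobalBalance R.jumpMatrix fun η => R.jumpMeasure μ η)
    (hne : (fun η : {η | 0 < h η} => h η * μ η) ≠ 0) :
    IsInvariantMeasure R.law (R.trace h) {η | 0 < h η} fun η => h η * μ η := by
  refine ⟨hne, fun t ht ξ => ?_⟩
  have hinv := R.tsum_mul_transition_of_globalBalance hrec (fun _ => ENNReal.coe_ne_top) hσ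
    (R.traceMean_ne_zero_iff.2 ξ.2.ne') ht
  simp only [jumpMeasure_mul_traceMean] at hinv
  have hsupp : Function.support (fun η => ((h η * μ η : ℝ≥0) : ℝ≥0∞)
      * R.transition (R.traceMean h) η ξ t) ⊆ {η | 0 < h η} := fun η hη =>
    (pos_iff_ne_zero (a := h η)).2 fun hzero : h η = 0 => hη (by simp [hzero])
  rw [← hinv, ← tsum_subtype_eq_of_support_subset hsupp]
  exact tsum_congr fun η => by rw [R.law_trace_eq hrec η.2.ne' ξ ht]

lemma isReversibleMeasure_trace (hrec : R.ChainRecurrent)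
    (hσ : DetailedBalance R.jumpMatrix fun η => R.jumpMeasure μ η)
    (hne : (fun η : {η | 0 < h η} => h η * μ η) ≠ 0) :
    IsReversibleMeasure R.law (R.trace h) {η | 0 < h η} fun η => h η * μ η := by
  refine ⟨hne, fun t ht η ξ => ?_⟩
  rw [← jumpMeasure_mul_traceMean, ← jumpMeasure_mul_traceMean,
    R.law_trace_eq hrec η.2.ne' _ ht, R.law_trace_eq hrec ξ.2.ne' _ ht]
  exact R.mul_transition_of_detailedBalance hrec (fun _ => ENNReal.coe_ne_top) hσ
    (R.traceMean_ne_zero_iff.2 η.2.ne') (R.traceMean_ne_zero_iff.2 ξ.2.ne') ht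

lemma tabooPotential_traceMean_ne_top (hirr : R.ChainIrreducible)
    (hσ : GlobalBalance R.jumpMatrix fun η => R.jumpMeasure μ η)
    (hη : R.jumpMeasure μ η ≠ 0) (hsum : Summable fun η => h η * μ η) (ξ : E) :
    tabooPotential R.jumpMatrix (fun ζ => R.traceMean h ζ) η ξ ≠ ∞ := by
  obtain ⟨n, hn⟩ := hirr.exists_killedPower_ne_zero η ξ
  refine tabooPotential_ne_top (fun htop => ?_) hn
  have hle := mul_tabooPotential_self_le R.jumpMatrix (fun ζ => R.traceMean h ζ) η hσ
  simp only [jumpMeasure_mul_traceMean] at hle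
  rw [htop, ENNReal.mul_top (by exact_mod_cast hη), top_le_iff] at hle
  exact ENNReal.tsum_coe_ne_top_iff_summable.2 hsum hle

lemma isPositiveRecurrent_trace (hirr : R.ChainIrreducible) (hrec : R.ChainRecurrent)
    (hσ : GlobalBalance R.jumpMatrix fun η => R.jumpMeasure μ η)
    (hσ₀ : ∀ η, R.jumpMeasure μ η ≠ 0) (hsum : Summable fun η => h η * μ η) :
    IsPositiveRecurrent R.law (R.trace h) {η | 0 < h η} := by
  intro η hη
  have hη₀ : h η ≠ 0 := ne_of_gt hη
  refine ⟨R.ae_not_bddAbove_trace_eq hrec hη₀, ?_⟩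
  by_cases hother : ∃ ξ, h ξ ≠ 0 ∧ ξ ≠ η
  · obtain ⟨ξ, hξ, hne⟩ := hother
    refine Or.inr ((R.lintegral_returnTime_trace_le hrec hne hη₀ hξ).trans_lt ?_)
    exact (tourPotential_ne_top fun b _ ζ =>
      R.tabooPotential_traceMean_ne_top hirr hσ (hσ₀ b) hsum ζ).lt_top
  · push Not at hother
    refine Or.inl ?_
    filter_upwards [R.ae_apply_trace_ne_zero hrec hη₀] with ω hω t ht
    exact hother _ (hω t ht)

end RateMatrix

end

theorem proposition6p3 {E : Type*} [Countable E] [MeasurableSpace E] [DiscreteMeasurableSpace E]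
    (R : RateMatrix E) (hirr : R.ChainIrreducible) (hrec : R.ChainRecurrent)
    (h : E → ℝ≥0) (F : Set E) (hF : F = {η | 0 < h η}) (hne : F.Nonempty)
    (μ : E → ℝ≥0) (hμ : IsInvariantMeasure R.law R.process univ fun η => μ η) :
    IsInvariantMeasure R.law (R.trace h) F (fun η => h η * μ η) ∧
    (Summable (fun η => h η * μ η) → IsPositiveRecurrent R.law (R.trace h) F) ∧
    (IsReversibleMeasure R.law R.process univ (fun η => μ η) →
      IsReversibleMeasure R.law (R.trace h) F fun η => h η * μ η) := by
  subst hF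
  have hσ := R.globalBalance_jumpMeasure hrec hμ
  have hσ₀ := R.jumpMeasure_ne_zero hirr hrec hμ
  have hν : (fun η : {η | 0 < h η} => h η * μ η) ≠ 0 := by
    obtain ⟨η, hη⟩ := hne
    exact Function.ne_iff.2 ⟨⟨η, hη⟩, mul_ne_zero (ne_of_gt hη) (div_ne_zero_iff.1 (hσ₀ η)).1⟩
  exact ⟨R.isInvariantMeasure_trace hrec hσ hν,
    fun hsum => R.isPositiveRecurrent_trace hirr hrec hσ hσ₀ hsum,
    fun hrev => R.isReversibleMeasure_trace hrec (R.detailedBalance_jumpMeasure hrec hrev) hν⟩
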